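/- All graphs are finite, simple and undirected. Let $G$ be a graph on $n$ vertices, with degrees $d(v)=d_G(v)$ and neighbourhoods $N(v)$. A vertex $v$ is \emph{heavy} if $d(v)\ge n/2$. A pair of distinct vertices $u,v$ with $d(u)+d(v)\ge n$ is \emph{$o$-heavy} if $uv\notin E(G)$ and \emph{$a$-heavy} if $uv\in E(G)$. For a graph $F$, $G$ is \emph{$F$-free} if no induced subgraph of $G$ is isomorphic to $F$, and \emph{$F$-$o$-heavy} if every induced subgraph of $G$ isomorphic to $F$ contains an $o$-heavy pair of $G$; $G$ is \emph{$\{F_1,F_2\}$-$o$-heavy} if it is both $F_1$-$o$-heavy and $F_2$-$o$-heavy. The \emph{claw} is $K_{1,3}$. The \emph{wounded} $W$ consists of a triangle $xyz$, a pendant edge $yp$ at $y$ and a path $zqr$ of length two at $z$ ($p,q,r$ being three further vertices). The \emph{net} consists of a triangle $a_1a_2a_3$ and three pendant edges $a_1b_1,a_2b_2,a_3b_3$. A graph is \emph{2-connected} if it has at least three vertices, is connected, and has no cut vertex. \textbf{$c$-closure.} For $x\in V(G)$ let $G^{BC}_x$ be obtained from $G$ by adding all edges $uv$ with $u,v\in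 N(x)$ such that $\{u,v\}$ is an $o$-heavy pair of $G$. The vertex $x$ is \emph{$c$-eligible} in $G$ if $N(x)$ is not a clique of $G$ and either (i) $G^{BC}_x[N(x)]$ is connected, or (ii) $G^{BC}_x[N(x)]$ is the disjoint union of two cliques $C_1$ and $C_2$, and there is an $o$-heavy pair $\{x,z\}$ of $G$ such that $zy_1,zy_2\in E(G)$ for some $y_1\in C_1$ and $y_2\in C_2$. The \emph{local $c$-completion} of $G$ at a $c$-eligible vertex $x$ adds all missing edges between vertices of $N(x)$. The \emph{$c$-closure} $\mathrm{cl}_c(G)$ is any graph obtained from $G$ by repeatedly performing local $c$-completions at $c$-eligible vertices (of the current graph) until no $c$-eligible vertex is left. \textbf{Heavy nets.} An induced net of a graph $H$, labelled as above, is \emph{$p$-heavy} if its triangle contains an $a$-heavy pair of $H$. It is \emph{$q$-heavy} if there is $i\in\{1,2,3\}$ such that $a_i$ and $b_i$ are heavy in $H$ and, for both $j\in\{1,2,3\}$ with $j\ne i$, $d_H(a_j)=3$, $d_H(b_j)=2$, and the neighbour of $b_j$ other than $a_j$ is heavy in $H$. The graph $H$ is \emph{$N$-$pq$-heavy} if every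 induced net of $H$ is $p$-heavy or $q$-heavy. \textbf{Theorem.} Let $G$ be a 2-connected $\{K_{1,3},W\}$-$o$-heavy graph. Then $\mathrm{cl}_c(G)$ is claw-free and $N$-$pq$-heavy. -/

import Mathlib

namespace CClosure

variable {V : Type*}

/-- The claw `K_{1,3}`. -/
abbrev claw : SimpleGraph (Fin 1 ⊕ Fin 3) :=
  completeBipartiteGraph (Fin 1) (Fin 3)

/-- The wounded `W`: the triangle `0 1 2`, with a pendant edge `1 3` attached to one of its
vertices and a pendant path `2 4 5` of length two attached to another one. -/
def wounded : SimpleGraph (Fin 6) :=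
  SimpleGraph.fromEdgeSet {s(0, 1), s(0, 2), s(1, 2), s(1, 3), s(2, 4), s(4, 5)}

/-- The net `N`: the triangle `a₁ a₂ a₃`, where `aᵢ = Sum.inl i`, with a pendant edge `aᵢ bᵢ`
attached to each of its vertices, where `bᵢ = Sum.inr i`. -/
def net : SimpleGraph (Fin 3 ⊕ Fin 3) :=
  SimpleGraph.fromRel fun x y =>
    match x, y with
    | Sum.inl _, Sum.inl _ => True
    | Sum.inl i, Sum.inr j => i = j
    | _, _ => False

/-- A graph is 2-connected if it has at least three vertices, is connected, and remains connected
after the deletion of any single vertex. -/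
def IsTwoConnected [Fintype V] (G : SimpleGraph V) : Prop :=
  3 ≤ Fintype.card V ∧ G.Connected ∧ ∀ v : V, (G.induce {v}ᶜ).Connected

open scoped Classical in
/-- The degree of a vertex, with classical decidability of adjacency. -/
noncomputable def deg [Fintype V] (G : SimpleGraph V) (v : V) : ℕ :=
  G.degree v

/-- A vertex `v` is heavy if `d(v) ≥ |V(G)| / 2`, that is, `|V(G)| ≤ 2 d(v)`. -/
def IsHeavy [Fintype V] (G : SimpleGraph V) (v : V) : Prop :=
  Fintype.card V ≤ 2 * deg G v

/-- An `o`-heavy pair: two distinct nonadjacent vertices with degree sum at least `|V(G)|`. -/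
def IsOHeavyPair [Fintype V] (G : SimpleGraph V) (u v : V) : Prop :=
  u ≠ v ∧ ¬ G.Adj u v ∧ Fintype.card V ≤ deg G u + deg G v

/-- An `a`-heavy pair: two adjacent vertices with degree sum at least `|V(G)|`. -/
def IsAHeavyPair [Fintype V] (G : SimpleGraph V) (u v : V) : Prop :=
  G.Adj u v ∧ Fintype.card V ≤ deg G u + deg G v

/-- `G` is `F`-free: it has no induced subgraph isomorphic to `F`. -/
def IsFree {W : Type*} (F : SimpleGraph W) (G : SimpleGraph V) : Prop :=
  IsEmpty (F ↪g G)

/-- `G` is `F`-`o`-heavy: every induced subgraph of `G` isomorphic to `F` contains an `o`-heavy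
pair of `G`. -/
def IsOHeavyFor [Fintype V] {W : Type*} (F : SimpleGraph W) (G : SimpleGraph V) : Prop :=
  ∀ f : F ↪g G, ∃ x y : W, IsOHeavyPair G (f x) (f y)

/-- The graph `G_x^{BC}`: each nonadjacent pair of neighbours of `x` with degree sum at least
`|V(G)|` is joined by an edge. -/
def bcGraph [Fintype V] (G : SimpleGraph V) (x : V) : SimpleGraph V where
  Adj u v := G.Adj u v ∨ (G.Adj x u ∧ G.Adj x v ∧ IsOHeavyPair G u v)
  symm := ⟨fun u v h => by
    rcases h with h | ⟨hu, hv, hne, hn, hd⟩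
    · exact Or.inl h.symm
    · exact Or.inr ⟨hv, hu, hne.symm, fun h => hn h.symm, by rwa [add_comm]⟩⟩
  loopless := ⟨fun u h => by
    rcases h with h | ⟨_, _, hne, _⟩
    · exact G.loopless.irrefl u h
    · exact hne rfl⟩

/-- The vertex `x` is `c`-eligible in `G`. -/
def IsCEligible [Fintype V] (G : SimpleGraph V) (x : V) : Prop :=
  ¬ G.IsClique (G.neighborSet x) ∧
    (((bcGraph G x).induce (G.neighborSet x)).Connected ∨
      ∃ C₁ C₂ : Set V,
        -- the graph induced by `bcGraph G x` on `N(x)` is the disjoint union of the cliques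
        C₁ ∪ C₂ = G.neighborSet x ∧ Disjoint C₁ C₂ ∧
        (bcGraph G x).IsClique C₁ ∧ (bcGraph G x).IsClique C₂ ∧
        (∀ u ∈ C₁, ∀ v ∈ C₂, ¬ (bcGraph G x).Adj u v) ∧
        ∃ z : V, IsOHeavyPair G x z ∧ (∃ y₁ ∈ C₁, G.Adj z y₁) ∧ ∃ y₂ ∈ C₂, G.Adj z y₂)

/-- The local `c`-completion `G_x^o`: all missing edges between neighbours of `x` are added. -/
def localCompletion (G : SimpleGraph V) (x : V) : SimpleGraph V where
  Adj u v := G.Adj u v ∨ (u ≠ v ∧ G.Adj x u ∧ G.Adj x v)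
  symm := ⟨fun u v h => by
    rcases h with h | ⟨hne, hu, hv⟩
    · exact Or.inl h.symm
    · exact Or.inr ⟨hne.symm, hv, hu⟩⟩
  loopless := ⟨fun u h => by
    rcases h with h | ⟨hne, _⟩
    · exact G.loopless.irrefl u h
    · exact hne rfl⟩

/-- One step of the closure procedure: local `c`-completion at a `c`-eligible vertex. -/
def CStep [Fintype V] (G H : SimpleGraph V) : Prop :=
  ∃ x : V, IsCEligible G x ∧ H = localCompletion G x

/-- `H` is a `c`-closure of `G`: it is obtained from `G` by a finite sequence of local
`c`-completions at `c`-eligible vertices, and it has no `c`-eligible vertex. -/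
def IsCClosure [Fintype V] (G H : SimpleGraph V) : Prop :=
  Relation.ReflTransGen CStep G H ∧ ∀ x : V, ¬ IsCEligible H x

theorem lt_of_cStep [Fintype V] {G H : SimpleGraph V} (h : CStep G H) : G < H := by
  obtain ⟨x, ⟨hx, -⟩, rfl⟩ := h
  refine lt_of_le_of_ne (fun u v huv => Or.inl huv) fun heq => hx ?_
  intro u hu v hv hne
  rw [heq]
  exact Or.inr ⟨hne, hu, hv⟩

/-- The closure procedure terminates, so every finite graph has a `c`-closure. -/
theorem exists_isCClosure [Fintype V] (G : SimpleGraph V) : ∃ H, IsCClosure G H := by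
  induction G using WellFoundedGT.induction with
  | ind G ih =>
    by_cases h : ∃ x, IsCEligible G x
    · obtain ⟨x, hx⟩ := h
      have hs : CStep G (localCompletion G x) := ⟨x, hx, rfl⟩
      obtain ⟨H, hH, hc⟩ := ih _ (lt_of_cStep hs)
      exact ⟨H, Relation.ReflTransGen.head hs hH, hc⟩
    · exact ⟨G, Relation.ReflTransGen.refl, fun x hx => h ⟨x, hx⟩⟩

/-- An induced net of `G`, with its labelling, is `p`-heavy: its triangle contains an `a`-heavy
pair of `G`. -/
def IsPHeavy [Fintype V] (G : SimpleGraph V) (f : net ↪g G) : Prop :=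
  ∃ i j : Fin 3, IsAHeavyPair G (f (Sum.inl i)) (f (Sum.inl j))

/-- An induced net of `G`, with its labelling, is `q`-heavy: for some `i`, both `aᵢ` and `bᵢ` are
heavy, and for both `j ≠ i` one has `d(aⱼ) = 3`, `d(bⱼ) = 2`, and the neighbour of `bⱼ` other than
`aⱼ` is heavy. -/
def IsQHeavy [Fintype V] (G : SimpleGraph V) (f : net ↪g G) : Prop :=
  ∃ i : Fin 3, IsHeavy G (f (Sum.inl i)) ∧ IsHeavy G (f (Sum.inr i)) ∧
    ∀ j : Fin 3, j ≠ i →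
      deg G (f (Sum.inl j)) = 3 ∧ deg G (f (Sum.inr j)) = 2 ∧
      ∀ c : V, G.Adj (f (Sum.inr j)) c → c ≠ f (Sum.inl j) → IsHeavy G c

/-- `G` is `N`-`pq`-heavy: every induced net of `G` is `p`-heavy or `q`-heavy. -/
def IsNPQHeavy [Fintype V] (G : SimpleGraph V) : Prop :=
  ∀ f : net ↪g G, IsPHeavy G f ∨ IsQHeavy G f

end CClosure

namespace CClosure

variable {V : Type*}

/-! Claw-`o`-heaviness survives every completion, and a claw-`o`-heavy graph without `c`-eligible
vertices has no `o`-heavy pair (`ClawHeavy.not_isOHeavyPair`). So the closure `H` is claw-free, and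
it is diamond-free: each edge lies in exactly one maximal clique (a line), and a vertex lies in at
most two of them.

The condition on `W` is never transferred to `H`; it is used in `G` through two links between the
graphs. A pair nonadjacent in `H` is neither an edge nor an `o`-heavy pair of `G`
(`ClosurePair.apart`), and `G` restricted to a line of `H` has no cut vertex (`Linked.of_cStep`).
Hence `H` certifies most missing pairs of a wounded in `G`, and `IsOHeavyFor.no_wounded` gives a
contradiction.

Take an induced net of `H` that is not `p`-heavy, with the line `K` of its triangle and the lines `L
i` of its pendant edges (the legs). Its triangle lies in `G` (`NetConfig.adj_triangle`): in a
connected part of `K` containing the corners, a vertex minimising the sum of the distances to them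
is a corner, since otherwise the shortest paths produce a wounded. At most one leg contains an
`o`-heavy pair of `G` (`NetConfig.exists_light`). Woundeds through the triangle force the other two
legs to be single edges whose ends continue into the remaining leg `L i`
(`NetConfig.exists_shortLeg`) and force `K` to be the triangle itself; this gives the degrees 3 and
2. Finally an `o`-heavy pair inside `L i`, with degrees bounded in terms of `|L i|`, yields `2 |L i|
≥ n + 2` (`NetConfig.ShortLeg.card_le`), so every vertex of `L i` is heavy and the net is `q`-heavy.
-/

/-! ### Degree counting and claw-heaviness under completion -/

theorem deg_eq_ncard [Fintype V] (G : SimpleGraph V) (v : V) :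
    deg G v = (G.neighborSet v).ncard := by
  classical
  unfold deg
  rw [← SimpleGraph.card_neighborSet_eq_degree, Set.ncard_eq_toFinset_card', Set.toFinset_card]

theorem deg_mono [Fintype V] {G H : SimpleGraph V} (h : G ≤ H) (v : V) : deg G v ≤ deg H v := by
  rw [deg_eq_ncard, deg_eq_ncard]
  exact Set.ncard_le_ncard (fun w hw => h hw) (Set.toFinite _)

theorem IsOHeavyPair.symm [Fintype V] {G : SimpleGraph V} {u v : V} (h : IsOHeavyPair G u v) :
    IsOHeavyPair G v u :=
  ⟨h.1.symm, fun hh => h.2.1 hh.symm, by rw [add_comm]; exact h.2.2⟩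

/-- If all common neighbours satisfied `P`, their images under `φ` together with `e` would be `|N(u)
∩ N(v)| + 1` vertices outside `N(u) ∪ N(v)`, and so `n ≥ d(u) + d(v) + 1`. -/
theorem exists_common_nbr_not [Fintype V] {G : SimpleGraph V} {u v : V}
    (hn : Fintype.card V ≤ deg G u + deg G v) (P : V → Prop) (φ : V → V) (e : V)
    (heu : ¬ G.Adj u e) (hev : ¬ G.Adj v e)
    (hφ : ∀ w, G.Adj u w → G.Adj v w → P w → ¬ G.Adj u (φ w) ∧ ¬ G.Adj v (φ w) ∧ φ w ≠ e)
    (hinj : ∀ w w', G.Adj u w → G.Adj v w → P w → G.Adj u w' → G.Adj v w' → P w' →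
      φ w = φ w' → w = w') :
    ∃ w, G.Adj u w ∧ G.Adj v w ∧ ¬ P w := by
  by_contra! hcon
  set A := G.neighborSet u
  set B := G.neighborSet v
  have h1 := Set.ncard_union_add_ncard_inter A B (Set.toFinite _) (Set.toFinite _)
  have h2 : (φ '' (A ∩ B)).ncard = (A ∩ B).ncard :=
    Set.InjOn.ncard_image fun w hw w' hw' h =>
      hinj w w' hw.1 hw.2 (hcon w hw.1 hw.2) hw'.1 hw'.2 (hcon w' hw'.1 hw'.2) h
  have h3 : (insert e (φ '' (A ∩ B))).ncard = (A ∩ B).ncard + 1 := by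
    rw [Set.ncard_insert_of_notMem, h2]
    rintro ⟨w, hw, rfl⟩
    exact (hφ w hw.1 hw.2 (hcon w hw.1 hw.2)).2.2 rfl
  have h4 : Disjoint (A ∪ B) (insert e (φ '' (A ∩ B))) := by
    rw [Set.disjoint_left]
    rintro x hx (rfl | ⟨w, hw, rfl⟩)
    · exact hx.elim heu hev
    · have := hφ w hw.1 hw.2 (hcon w hw.1 hw.2)
      exact hx.elim this.1 this.2.1
  have h5 := Set.ncard_union_eq h4 (Set.toFinite _) (Set.toFinite _)
  have h6 : ((A ∪ B) ∪ insert e (φ '' (A ∩ B))).ncard ≤ Fintype.card V := by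
    rw [← Nat.card_eq_fintype_card, ← Set.ncard_univ]
    exact Set.ncard_le_ncard (Set.subset_univ _) (Set.toFinite _)
  rw [deg_eq_ncard, deg_eq_ncard] at hn
  change _ ≤ A.ncard + B.ncard at hn
  omega

/-- Both `u` and `v` lie outside `N(u) ∪ N(v)`, so there are at least two common neighbours. The
constant `φ` is injective on the single vertex that `P` allows. -/
theorem IsOHeavyPair.exists_common_ne [Fintype V] {G : SimpleGraph V} {u v : V}
    (h : IsOHeavyPair G u v) (x : V) : ∃ w, G.Adj u w ∧ G.Adj v w ∧ w ≠ x :=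
  exists_common_nbr_not h.2.2 (· = x) (fun _ => v) u (G.loopless.irrefl u)
    (fun hh => h.2.1 hh.symm) (fun _ _ _ _ => ⟨h.2.1, G.loopless.irrefl v, h.1.symm⟩)
    (fun w w' _ _ hw _ _ hw' _ => by rw [hw, hw'])

/-- The vertex form of being claw-`o`-heavy. -/
def ClawHeavy [Fintype V] (G : SimpleGraph V) : Prop :=
  ∀ c x y z, G.Adj c x → G.Adj c y → G.Adj c z → x ≠ y → y ≠ z → x ≠ z →
    ¬ G.Adj x y → ¬ G.Adj y z → ¬ G.Adj x z →
    IsOHeavyPair G x y ∨ IsOHeavyPair G y z ∨ IsOHeavyPair G x z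

theorem IsOHeavyFor.clawHeavy [Fintype V] {G : SimpleGraph V} (h : IsOHeavyFor claw G) :
    ClawHeavy G := by
  intro c x y z hx hy hz hxy hyz hxz nxy nyz nxz
  have hinj : Function.Injective (Sum.elim (fun _ : Fin 1 => c) ![x, y, z]) := by
    have h1 := hx.ne
    have h2 := hy.ne
    have h3 := hz.ne
    rintro (i | i) (j | j) hij <;> fin_cases i <;> fin_cases j <;> simp_all
  obtain ⟨p, q, hpq⟩ := h
    { toFun := Sum.elim (fun _ => c) ![x, y, z]
      inj' := hinj
      map_rel_iff' := by
        have h1 := hx.symm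
        have h2 := hy.symm
        have h3 := hz.symm
        have h4 : ¬ G.Adj y x := fun hh => nxy hh.symm
        have h5 : ¬ G.Adj z x := fun hh => nxz hh.symm
        have h6 : ¬ G.Adj z y := fun hh => nyz hh.symm
        rintro (i | i) (j | j) <;> fin_cases i <;> fin_cases j <;>
          simp_all [claw, completeBipartiteGraph] }
  have hpq' : IsOHeavyPair G (Sum.elim (fun _ : Fin 1 => c) ![x, y, z] p)
    (Sum.elim (fun _ : Fin 1 => c) ![x, y, z] q) := hpq
  have h0 : ∀ v, ¬ IsOHeavyPair G v v := fun v hv => hv.1 rfl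
  have h1 : ∀ w, G.Adj c w → ¬ IsOHeavyPair G c w := fun w hw hv => hv.2.1 hw
  have h2 : ∀ w, G.Adj c w → ¬ IsOHeavyPair G w c := fun w hw hv => hv.2.1 hw.symm
  rcases p with p | p <;> rcases q with q | q <;> fin_cases p <;> fin_cases q <;>
    simp [h0, h1, h2, hx, hy, hz] at hpq'
  · exact Or.inl hpq'
  · exact Or.inr (Or.inr hpq')
  · exact Or.inl hpq'.symm
  · exact Or.inr (Or.inl hpq')
  · exact Or.inr (Or.inr hpq'.symm)
  · exact Or.inr (Or.inl hpq'.symm)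

theorem le_localCompletion (G : SimpleGraph V) (x : V) : G ≤ localCompletion G x :=
  fun _ _ h => Or.inl h

theorem IsOHeavyPair.mono [Fintype V] {G H : SimpleGraph V} (hGH : G ≤ H) {u v : V}
    (h : IsOHeavyPair G u v) (huv : ¬ H.Adj u v) : IsOHeavyPair H u v :=
  ⟨h.1, huv, h.2.2.trans (add_le_add (deg_mono hGH u) (deg_mono hGH v))⟩

/-- After the completion `a` sees `x` and all of `N(x)` except itself. This lets `x` stand in for
`a` in degree sums. -/
theorem deg_le_deg_localCompletion [Fintype V] {G : SimpleGraph V} {x a : V} (h : G.Adj x a) :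
    deg G x ≤ deg (localCompletion G x) a := by
  classical
  rw [deg_eq_ncard, deg_eq_ncard]
  have h1 : insert x (G.neighborSet x \ {a}) ⊆ (localCompletion G x).neighborSet a := by
    rintro w (rfl | ⟨hw, hwa⟩)
    · exact Or.inl h.symm
    · exact Or.inr ⟨fun e => hwa e.symm, h, hw⟩
  have h2 : (insert x (G.neighborSet x \ {a})).ncard = (G.neighborSet x).ncard := by
    rw [Set.ncard_insert_of_notMem (fun hx => G.loopless.irrefl x hx.1),
      Set.ncard_sdiff_singleton_add_one (s := G.neighborSet x) h (Set.toFinite _)]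
  rw [← h2]
  exact Set.ncard_le_ncard h1 (Set.toFinite _)

/-- In a claw using a new edge `c a`, replace `a` by `x`: this is a claw of `G`, and an `o`-heavy
pair containing `x` passes to `a` because the new degree of `a` is at least `d(x)`. -/
theorem ClawHeavy.localCompletion [Fintype V] {G : SimpleGraph V} (hG : ClawHeavy G) (x : V) :
    ClawHeavy (localCompletion G x) := by
  have hle := le_localCompletion G x
  -- a claw with one completed edge `c a`
  have key : ∀ c a p q, G.Adj x c → G.Adj x a → (CClosure.localCompletion G x).Adj c p →
      (CClosure.localCompletion G x).Adj c q → a ≠ p → p ≠ q → a ≠ q →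
      ¬ (CClosure.localCompletion G x).Adj a p → ¬ (CClosure.localCompletion G x).Adj p q →
      ¬ (CClosure.localCompletion G x).Adj a q →
      IsOHeavyPair (CClosure.localCompletion G x) a p ∨
      IsOHeavyPair (CClosure.localCompletion G x) p q ∨
      IsOHeavyPair (CClosure.localCompletion G x) a q := by
    intro c a p q hxc hxa hcp hcq hap hpq haq nap npq naq
    have hxp : ¬ G.Adj x p := fun h => nap (Or.inr ⟨hap, hxa, h⟩)
    have hxq : ¬ G.Adj x q := fun h => naq (Or.inr ⟨haq, hxa, h⟩)
    have hcp' : G.Adj c p := hcp.resolve_right fun h => hxp h.2.2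
    have hcq' : G.Adj c q := hcq.resolve_right fun h => hxq h.2.2
    have hxp' : x ≠ p := by rintro rfl; exact nap (hle hxa.symm)
    have hxq' : x ≠ q := by rintro rfl; exact naq (hle hxa.symm)
    have hd := deg_le_deg_localCompletion hxa
    rcases hG c x p q hxc.symm hcp' hcq' hxp' hpq hxq' hxp (fun h => npq (hle h)) hxq with h | h | h
    · exact Or.inl ⟨hap, nap, h.2.2.trans (add_le_add hd (deg_mono hle p))⟩
    · exact Or.inr (Or.inl (h.mono hle npq))
    · exact Or.inr (Or.inr ⟨haq, naq, h.2.2.trans (add_le_add hd (deg_mono hle q))⟩)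
  intro c a p q ha hp hq hap hpq haq nap npq naq
  have sw : ∀ {u v}, ¬ (CClosure.localCompletion G x).Adj u v →
      ¬ (CClosure.localCompletion G x).Adj v u := fun h h' => h h'.symm
  rcases ha with ha' | ⟨-, h1, h2⟩
  · rcases hp with hp' | ⟨-, h1, h2⟩
    · rcases hq with hq' | ⟨-, h1, h2⟩
      · rcases hG c a p q ha' hp' hq' hap hpq haq (fun h => nap (hle h)) (fun h => npq (hle h))
          (fun h => naq (hle h)) with h | h | h
        · exact Or.inl (h.mono hle nap)
        · exact Or.inr (Or.inl (h.mono hle npq))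
        · exact Or.inr (Or.inr (h.mono hle naq))
      · rcases key c q a p h1 h2 (hle ha') (hle hp') haq.symm hap hpq.symm (sw naq) nap
          (sw npq) with h | h | h
        · exact Or.inr (Or.inr h.symm)
        · exact Or.inl h
        · exact Or.inr (Or.inl h.symm)
    · rcases key c p a q h1 h2 (hle ha') hq hap.symm haq hpq (sw nap) naq npq with h | h | h
      · exact Or.inl h.symm
      · exact Or.inr (Or.inr h)
      · exact Or.inr (Or.inl h)
  · exact key c a p q h1 h2 hp hq hap hpq haq nap npq naq

/-! ### Neighbourhoods of vertices that are not eligible -/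

theorem IsOHeavyPair.bcAdj [Fintype V] {G : SimpleGraph V} {x u v : V} (h : IsOHeavyPair G u v)
    (hu : G.Adj x u) (hv : G.Adj x v) : (bcGraph G x).Adj u v :=
  Or.inr ⟨hu, hv, h⟩

/-- Among any three neighbours of `x`, two are adjacent in `bcGraph G x`; hence a nonadjacent pair
`p`, `q` dominates `N(x)`. -/
theorem ClawHeavy.bcAdj_or [Fintype V] {G : SimpleGraph V} (hG : ClawHeavy G) {x p q s : V}
    (hp : G.Adj x p) (hq : G.Adj x q) (hs : G.Adj x s) (hpq : p ≠ q)
    (npq : ¬ (bcGraph G x).Adj p q) (hsp : s ≠ p) (nsp : ¬ (bcGraph G x).Adj s p) (hsq : s ≠ q) :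
    (bcGraph G x).Adj s q := by
  by_contra nsq
  rcases hG x p q s hp hq hs hpq hsq.symm hsp.symm (fun h => npq (Or.inl h))
    (fun h => nsq (Or.inl h.symm)) (fun h => nsp (Or.inl h.symm)) with h | h | h
  · exact npq (h.bcAdj hp hq)
  · exact nsq (h.symm.bcAdj hs hq)
  · exact nsp (h.symm.bcAdj hs hp)

/-- If `p` and `q` are not joined in `bcGraph G x` and `x` is not `c`-eligible, then `p` and `q`
lie in different components of the neighbourhood of `x`. -/
theorem ClawHeavy.separated [Fintype V] {G : SimpleGraph V} (hG : ClawHeavy G) {x p q : V}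
    (hx : ¬ IsCEligible G x) (hp : G.Adj x p) (hq : G.Adj x q) (hpq : p ≠ q)
    (npq : ¬ (bcGraph G x).Adj p q) :
    (∀ s, G.Adj x s → ¬ ((bcGraph G x).Adj s p ∧ (bcGraph G x).Adj s q)) ∧
      ∀ z, IsOHeavyPair G x z → ¬ (G.Adj z p ∧ G.Adj z q) := by
  have hncl : ¬ G.IsClique (G.neighborSet x) := fun h => npq (Or.inl (h hp hq hpq))
  have hdisc : ¬ ((bcGraph G x).induce (G.neighborSet x)).Connected := fun h => hx ⟨hncl, Or.inl h⟩
  -- a link between the two sides makes the neighbourhood connected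
  have hlink : ∀ s t, G.Adj x s → G.Adj x t → (s = p ∨ (bcGraph G x).Adj s p) →
      (t = q ∨ (bcGraph G x).Adj t q) → ¬ (s = t ∨ (bcGraph G x).Adj s t) := by
    intro s t hs ht hsp htq hst
    apply hdisc
    set J := (bcGraph G x).induce (G.neighborSet x)
    have adj : ∀ u v (hu : G.Adj x u) (hv : G.Adj x v), (u = v ∨ (bcGraph G x).Adj u v) →
        J.Reachable ⟨u, hu⟩ ⟨v, hv⟩ := by
      rintro u v hu hv (rfl | h)
      · exact SimpleGraph.Reachable.refl _
      · exact SimpleGraph.Adj.reachable h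
    have hqp : J.Reachable ⟨q, hq⟩ ⟨p, hp⟩ :=
      ((adj t q ht hq htq).symm.trans (adj s t hs ht hst).symm).trans (adj s p hs hp hsp)
    have hall : ∀ w : G.neighborSet x, J.Reachable w ⟨p, hp⟩ := by
      rintro ⟨w, hw⟩
      by_cases h1 : w = p ∨ (bcGraph G x).Adj w p
      · exact adj w p hw hp h1
      · push Not at h1
        by_cases h2 : w = q
        · exact (adj w q hw hq (Or.inl h2)).trans hqp
        · exact (adj w q hw hq (Or.inr (hG.bcAdj_or hp hq hw hpq npq h1.1 h1.2 h2))).trans hqp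
    have : Nonempty (G.neighborSet x) := ⟨⟨p, hp⟩⟩
    exact ⟨fun u v => (hall u).trans (hall v).symm⟩
  refine ⟨fun s hs h => hlink s s hs hs (Or.inr h.1) (Or.inr h.2) (Or.inl rfl), ?_⟩
  rintro z hz ⟨hzp, hzq⟩
  -- The closed neighbourhoods of `p` and `q` in `bcGraph G x` split `N(x)` into two cliques, and
  -- `z` would make `x` eligible by clause (ii).
  refine hx ⟨hncl, Or.inr ⟨{s | G.Adj x s ∧ (s = p ∨ (bcGraph G x).Adj s p)},
    {s | G.Adj x s ∧ (s = q ∨ (bcGraph G x).Adj s q)}, ?_, ?_, ?_, ?_, ?_, z, hz,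
    ⟨p, ⟨hp, Or.inl rfl⟩, hzp⟩, q, ⟨hq, Or.inl rfl⟩, hzq⟩⟩
  · ext s
    constructor
    · rintro (h | h) <;> exact h.1
    · intro hs
      by_cases h1 : s = p ∨ (bcGraph G x).Adj s p
      · exact Or.inl ⟨hs, h1⟩
      · push Not at h1
        by_cases h2 : s = q
        · exact Or.inr ⟨hs, Or.inl h2⟩
        · exact Or.inr ⟨hs, Or.inr (hG.bcAdj_or hp hq hs hpq npq h1.1 h1.2 h2)⟩
  · rw [Set.disjoint_left]
    rintro s ⟨hs, h1⟩ ⟨-, h2⟩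
    exact hlink s s hs hs h1 h2 (Or.inl rfl)
  · rintro s ⟨hs, h1⟩ t ⟨ht, h2⟩ hst
    by_contra nst
    have hsq : ∀ s, G.Adj x s → (s = p ∨ (bcGraph G x).Adj s p) →
        s ≠ q ∧ ¬ (bcGraph G x).Adj q s := fun s hs h1 =>
      ⟨fun e => hlink s q hs hq h1 (Or.inl rfl) (Or.inl e),
        fun e => hlink s q hs hq h1 (Or.inl rfl) (Or.inr e.symm)⟩
    exact (hsq t ht h2).2 (hG.bcAdj_or hs ht hq hst nst (hsq s hs h1).1.symm
      (hsq s hs h1).2 (hsq t ht h2).1.symm)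
  · rintro s ⟨hs, h1⟩ t ⟨ht, h2⟩ hst
    by_contra nst
    have hsq : ∀ s, G.Adj x s → (s = q ∨ (bcGraph G x).Adj s q) →
        s ≠ p ∧ ¬ (bcGraph G x).Adj p s := fun s hs h1 =>
      ⟨fun e => hlink p s hp hs (Or.inl rfl) h1 (Or.inl e.symm),
        fun e => hlink p s hp hs (Or.inl rfl) h1 (Or.inr e)⟩
    exact (hsq t ht h2).2 (hG.bcAdj_or hs ht hp hst nst (hsq s hs h1).1.symm
      (hsq s hs h1).2 (hsq t ht h2).1.symm)
  · rintro s ⟨hs, h1⟩ t ⟨ht, h2⟩ hst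
    exact hlink s t hs ht h1 h2 (Or.inr hst)

/-- A claw-`o`-heavy graph without `c`-eligible vertices has no `o`-heavy pair. -/
theorem ClawHeavy.not_isOHeavyPair [Fintype V] {G : SimpleGraph V} (hG : ClawHeavy G)
    (hcl : ∀ x, ¬ IsCEligible G x) (u v : V) : ¬ IsOHeavyPair G u v := by
  intro huv
  -- every common neighbour has a neighbour far from `u` and `v`
  have hφ : ∀ w, ∃ t, G.Adj u w → G.Adj v w → G.Adj w t ∧ t ≠ u ∧ t ≠ v ∧
      ¬ (bcGraph G w).Adj u t ∧ ¬ (bcGraph G w).Adj v t := by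
    intro w
    by_cases hw : G.Adj u w ∧ G.Adj v w
    · by_contra! hcon
      have hncl : ¬ G.IsClique (G.neighborSet w) := fun h =>
        huv.2.1 (h hw.1.symm hw.2.symm huv.1)
      refine hcl w ⟨hncl, Or.inl ?_⟩
      set J := (bcGraph G w).induce (G.neighborSet w)
      have hvu : J.Reachable ⟨v, hw.2.symm⟩ ⟨u, hw.1.symm⟩ :=
        SimpleGraph.Adj.reachable (huv.symm.bcAdj hw.2.symm hw.1.symm)
      have hall : ∀ s : G.neighborSet w, J.Reachable s ⟨u, hw.1.symm⟩ := by
        rintro ⟨s, hs⟩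
        by_cases h1 : s = u
        · subst h1; exact SimpleGraph.Reachable.refl _
        by_cases h2 : s = v
        · subst h2; exact hvu
        by_cases h3 : (bcGraph G w).Adj u s
        · exact SimpleGraph.Adj.reachable h3.symm
        · have h4 := (hcon s).2.2 hs h1 h2 h3
          refine SimpleGraph.Reachable.trans (v := ⟨v, hw.2.symm⟩) ?_ hvu
          exact SimpleGraph.Adj.reachable h4.symm
      have : Nonempty (G.neighborSet w) := ⟨⟨u, hw.1.symm⟩⟩
      exact ⟨fun a b => (hall a).trans (hall b).symm⟩
    · exact ⟨u, fun h1 h2 => absurd ⟨h1, h2⟩ hw⟩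
  choose φ hφ using hφ
  by_cases hinj : ∀ w w', G.Adj u w → G.Adj v w → G.Adj u w' → G.Adj v w' →
      φ w = φ w' → w = w'
  · obtain ⟨w, -, -, h⟩ := exists_common_nbr_not huv.2.2 (fun _ => True) φ u (G.loopless.irrefl u)
      (fun h => huv.2.1 h.symm)
      (fun w h1 h2 _ => ⟨fun h => (hφ w h1 h2).2.2.2.1 (Or.inl h),
        fun h => (hφ w h1 h2).2.2.2.2 (Or.inl h), (hφ w h1 h2).2.1⟩)
      (fun w w' h1 h2 _ h3 h4 _ h => hinj w w' h1 h2 h3 h4 h)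
    exact h trivial
  · push Not at hinj
    -- Here `w` and `w'` share the far neighbour `t`. As `w'` sees both `u` and `t`, separation at
    -- `w` forbids `w w'` as an edge and as an `o`-heavy pair. So `w` and `w'` are separated at `u`,
    -- contrary to `v`, which is `o`-heavy with `u` and sees both.
    obtain ⟨w, w', h1, h2, h3, h4, he, hne⟩ := hinj
    obtain ⟨ht, htu, htv, hut, hvt⟩ := hφ w h1 h2
    obtain ⟨ht', -⟩ := hφ w' h3 h4
    rw [← he] at ht'
    have hsep := hG.separated (hcl w) h1.symm ht htu.symm hut
    have nww : ¬ G.Adj w w' := fun h => hsep.1 w' h ⟨Or.inl h3.symm, Or.inl ht'⟩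
    have hnh : ¬ IsOHeavyPair G w w' := fun h => hsep.2 w' h ⟨h3.symm, ht'⟩
    have nbc : ¬ (bcGraph G u).Adj w w' := by
      rintro (h | h)
      · exact nww h
      · exact hnh h.2.2
    exact (hG.separated (hcl u) h1 h3 hne nbc).2 v huv ⟨h2, h4⟩

/-! ### Claw-free and diamond-free closures, and excluding the wounded -/

/-- The vertex form of claw-freeness. -/
def ClawFree (H : SimpleGraph V) : Prop :=
  ∀ c x y z, H.Adj c x → H.Adj c y → H.Adj c z → x ≠ y → y ≠ z → x ≠ z →
    H.Adj x y ∨ H.Adj y z ∨ H.Adj x z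

theorem ClawFree.isFree {H : SimpleGraph V} (h : ClawFree H) : IsFree claw H := by
  refine ⟨fun f => ?_⟩
  have hadj : ∀ i : Fin 3, H.Adj (f (Sum.inl 0)) (f (Sum.inr i)) := fun i =>
    f.map_adj_iff.2 (by simp [claw])
  have hn : ∀ i j : Fin 3, ¬ H.Adj (f (Sum.inr i)) (f (Sum.inr j)) := fun i j hh => by
    have := f.map_adj_iff.1 hh
    simp [claw] at this
  have hne : ∀ i j : Fin 3, i ≠ j → f (Sum.inr i) ≠ f (Sum.inr j) := fun i j hij hh =>
    hij (Sum.inr_injective (f.injective hh))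
  rcases h _ _ _ _ (hadj 0) (hadj 1) (hadj 2) (hne 0 1 (by decide)) (hne 1 2 (by decide))
    (hne 0 2 (by decide)) with h | h | h <;> exact hn _ _ h

/-- Two distinct common neighbours of the ends of an edge are adjacent. -/
def DiamondFree (H : SimpleGraph V) : Prop :=
  ∀ u v w w', H.Adj u v → H.Adj u w → H.Adj v w → H.Adj u w' → H.Adj v w' → w ≠ w' → H.Adj w w'

theorem ClawHeavy.clawFree [Fintype V] {H : SimpleGraph V} (hH : ClawHeavy H)
    (hno : ∀ u v, ¬ IsOHeavyPair H u v) : ClawFree H := by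
  intro c x y z hx hy hz hxy hyz hxz
  by_contra! hcon
  rcases hH c x y z hx hy hz hxy hyz hxz hcon.1 hcon.2.1 hcon.2.2 with h | h | h <;>
    exact hno _ _ h

/-- Nonadjacent `w`, `w'` would be separated at `u`, while `v` is joined to both. -/
theorem ClawHeavy.diamondFree [Fintype V] {H : SimpleGraph V} (hH : ClawHeavy H)
    (hcl : ∀ x, ¬ IsCEligible H x) : DiamondFree H := by
  intro u v w w' huv huw hvw huw' hvw' hne
  by_contra hww
  refine (hH.separated (hcl u) huw huw' hne ?_).1 v huv ⟨Or.inl hvw, Or.inl hvw'⟩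
  rintro (h | h)
  · exact hww h
  · exact hH.not_isOHeavyPair hcl _ _ h.2.2

/-- Two vertices that are neither adjacent nor an `o`-heavy pair. -/
def Apart [Fintype V] (G : SimpleGraph V) (u v : V) : Prop :=
  ¬ G.Adj u v ∧ ¬ IsOHeavyPair G u v

theorem Apart.symm [Fintype V] {G : SimpleGraph V} {u v : V} (h : Apart G u v) : Apart G v u :=
  ⟨fun hh => h.1 hh.symm, fun hh => h.2 hh.symm⟩

theorem IsOHeavyFor.no_wounded [Fintype V] {G : SimpleGraph V} (h : IsOHeavyFor wounded G)
    {t y z p q r : V} (hty : G.Adj t y) (htz : G.Adj t z) (hyz : G.Adj y z) (hyp : G.Adj y p)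
    (hzq : G.Adj z q) (hqr : G.Adj q r) (tp : Apart G t p) (tq : Apart G t q) (tr : Apart G t r)
    (yq : Apart G y q) (yr : Apart G y r) (zp : Apart G z p) (zr : Apart G z r)
    (pq : Apart G p q) (pr : Apart G p r) : False := by
  have hadj : ∀ i j : Fin 6, G.Adj (![t, y, z, p, q, r] i) (![t, y, z, p, q, r] j) ↔
      wounded.Adj i j := by
    have h1 := hty.symm
    have h2 := htz.symm
    have h3 := hyz.symm
    have h4 := hyp.symm
    have h5 := hzq.symm
    have h6 := hqr.symm
    have n1 := tp.1
    have n2 := tq.1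
    have n3 := tr.1
    have n4 := yq.1
    have n5 := yr.1
    have n6 := zp.1
    have n7 := zr.1
    have n8 := pq.1
    have n9 := pr.1
    have m1 := tp.symm.1
    have m2 := tq.symm.1
    have m3 := tr.symm.1
    have m4 := yq.symm.1
    have m5 := yr.symm.1
    have m6 := zp.symm.1
    have m7 := zr.symm.1
    have m8 := pq.symm.1
    have m9 := pr.symm.1
    intro i j
    fin_cases i <;> fin_cases j <;> simp [wounded, *]
  -- No two vertices of `W` have the same neighbourhood, so distinctness of the six vertices follows
  -- from the adjacency pattern.
  have twin : ∀ i j : Fin 6, (∀ k, wounded.Adj i k ↔ wounded.Adj j k) → i = j := by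
    simp only [wounded, SimpleGraph.fromEdgeSet_adj, Set.mem_insert_iff, Set.mem_singleton_iff]
    decide
  have hinj : Function.Injective ![t, y, z, p, q, r] := fun i j hij =>
    twin i j fun k => by rw [← hadj, ← hadj, hij]
  obtain ⟨i, j, hij⟩ := h ⟨⟨_, hinj⟩, fun {i j} => hadj i j⟩
  have hij' : IsOHeavyPair G (![t, y, z, p, q, r] i) (![t, y, z, p, q, r] j) := hij
  have hne : ¬ wounded.Adj i j := fun hh => hij'.2.1 ((hadj i j).2 hh)
  have hne' : i ≠ j := by rintro rfl; exact hij'.1 rfl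
  have n1 := tp.2
  have n2 := tq.2
  have n3 := tr.2
  have n4 := yq.2
  have n5 := yr.2
  have n6 := zp.2
  have n7 := zr.2
  have n8 := pq.2
  have n9 := pr.2
  have m1 := tp.symm.2
  have m2 := tq.symm.2
  have m3 := tr.symm.2
  have m4 := yq.symm.2
  have m5 := yr.symm.2
  have m6 := zp.symm.2
  have m7 := zr.symm.2
  have m8 := pq.symm.2
  have m9 := pr.symm.2
  revert hij' hne hne'
  clear hij hadj hinj twin
  fin_cases i <;> fin_cases j <;> simp [wounded, *]

/-! ### Lines of the closure have no cut vertex in the original graph -/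

/-- A maximal clique of a diamond-free graph, or a set with at most one vertex. -/
def IsLine (H : SimpleGraph V) (Q : Set V) : Prop :=
  (∀ x ∈ Q, ∀ y ∈ Q, x ≠ y → H.Adj x y) ∧
    ∀ x ∈ Q, ∀ y ∈ Q, x ≠ y → ∀ v, H.Adj v x → H.Adj v y → v ∈ Q

/-- `G` restricted to `Q` stays connected after the deletion of at most one vertex. -/
def Linked (G : SimpleGraph V) (Q : Set V) : Prop :=
  ∀ Y S : Set V, Y.Subsingleton → ∀ u ∈ Q, u ∈ S → u ∉ Y → ∀ v ∈ Q, v ∉ S → v ∉ Y →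
    ∃ s ∈ Q, s ∈ S ∧ s ∉ Y ∧ ∃ t ∈ Q, t ∉ S ∧ t ∉ Y ∧ G.Adj s t

/-- What is needed of a graph `G` and its `c`-closure `H`. -/
structure ClosurePair [Fintype V] (G H : SimpleGraph V) : Prop where
  le : G ≤ H
  claw : ClawFree H
  diamond : DiamondFree H
  noHeavy : ∀ u v, ¬ IsOHeavyPair H u v
  clawG : ClawHeavy G
  wounded : IsOHeavyFor wounded G
  linked : ∀ Q, IsLine H Q → Linked G Q
  twoConn : ∀ (y : V) (S : Set V), ∀ u ∈ S, u ≠ y → ∀ v ∉ S, v ≠ y →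
    ∃ s ∈ S, s ≠ y ∧ ∃ t ∉ S, t ≠ y ∧ H.Adj s t

theorem exists_adj_of_connected {W : Type*} {J : SimpleGraph W} (hJ : J.Connected) (S : Set W)
    {u v : W} (hu : u ∈ S) (hv : v ∉ S) : ∃ s ∈ S, ∃ t ∉ S, J.Adj s t := by
  obtain ⟨p⟩ := hJ.preconnected u v
  obtain ⟨d, -, h1, h2⟩ := p.exists_boundary_dart S hu hv
  exact ⟨_, h1, _, h2, d.adj⟩

/-- Suppose the crossing edge `s t` was added at `x`; then `x ∈ Q`. If `x` is not deleted, one of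
its edges to `s` and `t` crosses. If `x` is the deleted vertex, then `N(x) ⊆ Q`, and either clause
of eligibility yields a crossing edge avoiding `x`. -/
theorem Linked.of_cStep [Fintype V] {G G' H : SimpleGraph V} (hstep : CStep G G') (hle : G' ≤ H)
    {Q : Set V} (hQ : IsLine H Q) (h : Linked G' Q) : Linked G Q := by
  obtain ⟨x, hx, rfl⟩ := hstep
  intro Y S hY u hu huS huY v hv hvS hvY
  obtain ⟨s, hs, hsS, hsY, t, ht, htS, htY, hst⟩ := h Y S hY u hu huS huY v hv hvS hvY
  rcases hst with hst | ⟨hne, hxs, hxt⟩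
  · exact ⟨s, hs, hsS, hsY, t, ht, htS, htY, hst⟩
  have hGH : G ≤ H := (le_localCompletion G x).trans hle
  have hxQ : x ∈ Q := hQ.2 s hs t ht hne x (hGH hxs) (hGH hxt)
  by_cases hxY : x ∈ Y
  · -- everything near `x` lies in `Q`
    have hN : ∀ w, G.Adj x w → w ∈ Q := by
      intro w hw
      by_cases h1 : w = s
      · exact h1 ▸ hs
      · exact hQ.2 x hxQ s hs hxs.ne w (hGH hw.symm) (hle (Or.inr ⟨h1, hw, hxs⟩))
    have hYx : ∀ w, w ≠ x → w ∉ Y := fun w hw hwY => hw (hY hwY hxY)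
    have hcross : ∀ p q, G.Adj x p → G.Adj x q → p ∈ S → q ∉ S → (bcGraph G x).Adj p q →
        ∃ s ∈ Q, s ∈ S ∧ s ∉ Y ∧ ∃ t ∈ Q, t ∉ S ∧ t ∉ Y ∧ G.Adj s t := by
      rintro p q hp hq hpS hqS (h | ⟨-, -, h⟩)
      · exact ⟨p, hN p hp, hpS, hYx p hp.ne', q, hN q hq, hqS, hYx q hq.ne', h⟩
      -- An edge of `bcGraph G x` missing in `G` is replaced by a path through a common neighbour
      -- other than the deleted `x`.
      · obtain ⟨w, h1, h2, h3⟩ := h.exists_common_ne x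
        have hw : w ∈ Q := hQ.2 p (hN p hp) q (hN q hq) h.1 w (hGH h1.symm) (hGH h2.symm)
        by_cases hwS : w ∈ S
        · exact ⟨w, hw, hwS, hYx w h3, q, hN q hq, hqS, hYx q hq.ne', h2.symm⟩
        · exact ⟨p, hN p hp, hpS, hYx p hp.ne', w, hw, hwS, hYx w h3, h1⟩
    rcases hx.2 with hc | ⟨C₁, C₂, hC, hdis, hc1, hc2, -, z, hxz, ⟨y₁, hy1, hzy1⟩, y₂, hy2, hzy2⟩
    · obtain ⟨⟨p, hp⟩, hpS, ⟨q, hq⟩, hqS, hpq⟩ := exists_adj_of_connected hc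
        {w | (w : V) ∈ S} (u := ⟨s, hxs⟩) (v := ⟨t, hxt⟩) hsS htS
      exact hcross p q hp hq hpS hqS hpq
    · have hx1 : ∀ w ∈ C₁, G.Adj x w := fun w hw => by
        have : w ∈ C₁ ∪ C₂ := Or.inl hw
        rwa [hC] at this
      have hx2 : ∀ w ∈ C₂, G.Adj x w := fun w hw => by
        have : w ∈ C₁ ∪ C₂ := Or.inr hw
        rwa [hC] at this
      have hy12 : y₁ ≠ y₂ := fun e => Set.disjoint_left.1 hdis hy1 (e ▸ hy2)
      have hzQ : z ∈ Q := hQ.2 y₁ (hN _ (hx1 _ hy1)) y₂ (hN _ (hx2 _ hy2)) hy12 z (hGH hzy1)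
        (hGH hzy2)
      have hzY := hYx z hxz.1.symm
      -- a clique meeting both sides is crossed, otherwise `z` links the two cliques
      have hclq : ∀ C : Set V, (bcGraph G x).IsClique C → (∀ w ∈ C, G.Adj x w) → ∀ p ∈ C, p ∈ S →
          ∀ q ∈ C, q ∉ S → ∃ s ∈ Q, s ∈ S ∧ s ∉ Y ∧ ∃ t ∈ Q, t ∉ S ∧ t ∉ Y ∧ G.Adj s t :=
        fun C hC hxC p hp hpS q hq hqS => hcross p q (hxC p hp) (hxC q hq) hpS hqS
          (hC hp hq fun e => hqS (e ▸ hpS))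
      have hfin : ∀ p q, G.Adj x p → G.Adj x q → G.Adj z p → G.Adj z q → p ∈ S → q ∉ S →
          ∃ s ∈ Q, s ∈ S ∧ s ∉ Y ∧ ∃ t ∈ Q, t ∉ S ∧ t ∉ Y ∧ G.Adj s t := by
        intro p q hp hq hzp hzq hpS hqS
        by_cases hzS : z ∈ S
        · exact ⟨z, hzQ, hzS, hzY, q, hN q hq, hqS, hYx q hq.ne', hzq⟩
        · exact ⟨p, hN p hp, hpS, hYx p hp.ne', z, hzQ, hzS, hzY, hzp.symm⟩
      by_cases h1 : y₁ ∈ S <;> by_cases h2 : y₂ ∈ S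
      · have htC : t ∈ C₁ ∪ C₂ := by rw [hC]; exact hxt
        rcases htC with htC | htC
        · exact hclq C₁ hc1 hx1 y₁ hy1 h1 t htC htS
        · exact hclq C₂ hc2 hx2 y₂ hy2 h2 t htC htS
      · exact hfin y₁ y₂ (hx1 _ hy1) (hx2 _ hy2) hzy1 hzy2 h1 h2
      · exact hfin y₂ y₁ (hx2 _ hy2) (hx1 _ hy1) hzy2 hzy1 h2 h1
      · have hsC : s ∈ C₁ ∪ C₂ := by rw [hC]; exact hxs
        rcases hsC with hsC | hsC
        · exact hclq C₁ hc1 hx1 s hsC hsS y₁ hy1 h1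
        · exact hclq C₂ hc2 hx2 s hsC hsS y₂ hy2 h2
  · by_cases hxS : x ∈ S
    · exact ⟨x, hxQ, hxS, hxY, t, ht, htS, htY, hxt⟩
    · exact ⟨s, hs, hsS, hsY, x, hxQ, hxS, hxY, hxs.symm⟩

theorem le_of_reflTransGen_cStep [Fintype V] {G H : SimpleGraph V}
    (h : Relation.ReflTransGen CStep G H) : G ≤ H := by
  induction h with
  | refl => exact le_rfl
  | tail _ h ih => exact ih.trans (lt_of_cStep h).le

theorem IsCClosure.closurePair [Fintype V] {G H : SimpleGraph V} (h : IsCClosure G H)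
    (h2 : IsTwoConnected G) (hclaw : IsOHeavyFor CClosure.claw G)
    (hW : IsOHeavyFor CClosure.wounded G) : ClosurePair G H := by
  have hle := le_of_reflTransGen_cStep h.1
  have hH : ClawHeavy H := by
    have h1 := h.1
    clear h hle
    induction h1 with
    | refl => exact hclaw.clawHeavy
    | tail _ h ih => obtain ⟨x, -, rfl⟩ := h; exact ih.localCompletion x
  refine ⟨hle, hH.clawFree (hH.not_isOHeavyPair h.2), hH.diamondFree h.2,
    hH.not_isOHeavyPair h.2, hclaw.clawHeavy, hW, ?_, ?_⟩
  · intro Q hQ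
    -- The induction runs backwards from `H`, where `Q` is a clique.
    refine Relation.ReflTransGen.head_induction_on (motive := fun K _ => Linked K Q) h.1 ?_ ?_
    · intro Y S _ u hu huS huY v hv hvS hvY
      exact ⟨u, hu, huS, huY, v, hv, hvS, hvY, hQ.1 u hu v hv fun e => hvS (e ▸ huS)⟩
    · intro A B hAB hBH ih
      exact ih.of_cStep hAB (le_of_reflTransGen_cStep hBH) hQ
  · intro y S u huS huy v hvS hvy
    obtain ⟨⟨s, hs⟩, hsS, ⟨t, ht⟩, htS, hst⟩ := exists_adj_of_connected (h2.2.2 y)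
      {w | (w : V) ∈ S} (u := ⟨u, huy⟩) (v := ⟨v, hvy⟩) huS hvS
    exact ⟨s, hsS, hs, t, htS, ht, hle hst⟩

/-! ### Incidence of vertices and lines -/

section Lines

variable {H : SimpleGraph V} {Q X : Set V}

theorem DiamondFree.exists_isLine (hH : DiamondFree H) {u v : V} (huv : H.Adj u v) :
    ∃ Q, IsLine H Q ∧ u ∈ Q ∧ v ∈ Q := by
  refine ⟨{w | (w = u ∨ H.Adj w u) ∧ (w = v ∨ H.Adj w v)}, ⟨?_, ?_⟩, ⟨Or.inl rfl, Or.inr huv⟩,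
    ⟨Or.inr huv.symm, Or.inl rfl⟩⟩
  · rintro x ⟨hxu, hxv⟩ y ⟨hyu, hyv⟩ hne
    rcases hxu with rfl | hxu
    · rcases hyu with rfl | hyu
      · exact absurd rfl hne
      · exact hyu.symm
    rcases hxv with rfl | hxv
    · rcases hyv with rfl | hyv
      · exact absurd rfl hne
      · exact hyv.symm
    rcases hyu with rfl | hyu
    · exact hxu
    rcases hyv with rfl | hyv
    · exact hxv
    exact hH u v x y huv hxu.symm hxv.symm hyu.symm hyv.symm hne
  · rintro x ⟨hxu, hxv⟩ y ⟨hyu, hyv⟩ hne w hwx hwy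
    have hxy : H.Adj x y := by
      rcases hxu with rfl | hxu
      · exact (hyu.resolve_left hne.symm).symm
      rcases hyu with rfl | hyu
      · exact hxu
      rcases hxv with rfl | hxv
      · exact (hyv.resolve_left hne.symm).symm
      rcases hyv with rfl | hyv
      · exact hxv
      exact hH u v x y huv hxu.symm hxv.symm hyu.symm hyv.symm hne
    have fin : ∀ p, (x = p ∨ H.Adj x p) → (y = p ∨ H.Adj y p) → (w = p ∨ H.Adj w p) := by
      intro p hx hy
      rcases hx with rfl | hx
      · exact Or.inr hwx
      rcases hy with rfl | hy
      · exact Or.inr hwy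
      by_cases hwp : w = p
      · exact Or.inl hwp
      · exact Or.inr (hH x y w p hxy hwx.symm hwy.symm hx hy hwp)
    exact ⟨fin u hxu hyu, fin v hxv hyv⟩

theorem IsLine.subset (hQ : IsLine H Q) (hX : IsLine H X) {x y : V} (hxQ : x ∈ Q) (hyQ : y ∈ Q)
    (hxX : x ∈ X) (hyX : y ∈ X) (hne : x ≠ y) : Q ⊆ X := by
  intro z hz
  by_cases h1 : z = x
  · exact h1 ▸ hxX
  by_cases h2 : z = y
  · exact h2 ▸ hyX
  exact hX.2 x hxX y hyX hne z (hQ.1 z hz x hxQ h1) (hQ.1 z hz y hyQ h2)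

/-- A vertex outside a line is adjacent to at most one vertex of the line. -/
theorem IsLine.unique (hQ : IsLine H Q) {x y v : V} (hx : x ∈ Q) (hy : y ∈ Q) (hv : v ∉ Q)
    (h1 : H.Adj v x) (h2 : H.Adj v y) : x = y := by
  by_contra hne
  exact hv (hQ.2 x hx y hy hne v h1 h2)

/-- The neighbours of `x ∈ Q` outside the line `Q` form a clique. -/
theorem IsLine.adj_of_notMem (hQ : IsLine H Q) (hc : ClawFree H) {x x' u v : V} (hx : x ∈ Q)
    (hx' : x' ∈ Q) (hne : x' ≠ x) (hu : u ∉ Q) (hv : v ∉ Q) (h1 : H.Adj x u) (h2 : H.Adj x v)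
    (huv : u ≠ v) : H.Adj u v := by
  have hux : ∀ u, u ∉ Q → H.Adj x u → ¬ H.Adj x' u := fun u hu h h' =>
    hu (hQ.2 x hx x' hx' hne.symm u h.symm h'.symm)
  rcases hc x x' u v (hQ.1 x hx x' hx' hne.symm) h1 h2 (fun e => hu (e ▸ hx')) huv
    (fun e => hv (e ▸ hx')) with h | h | h
  · exact absurd h (hux u hu h1)
  · exact h
  · exact absurd h (hux v hv h2)

/-- A vertex in two lines has all its neighbours there. -/
theorem IsLine.mem_or_mem (hQ : IsLine H Q) (hX : IsLine H X) (hc : ClawFree H) {x q y v : V}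
    (hxQ : x ∈ Q) (hq : q ∈ Q) (hqx : q ≠ x) (hxX : x ∈ X) (hy : y ∈ X) (hyQ : y ∉ Q)
    (hv : H.Adj x v) : v ∈ Q ∨ v ∈ X := by
  by_cases hvQ : v ∈ Q
  · exact Or.inl hvQ
  have hyx : y ≠ x := fun e => hyQ (e ▸ hxQ)
  by_cases hvy : v = y
  · exact Or.inr (hvy ▸ hy)
  · exact Or.inr (hX.2 x hxX y hy hyx.symm v hv.symm (hQ.adj_of_notMem hc hxQ hq hqx hvQ hyQ hv
      (hX.1 x hxX y hy hyx.symm) hvy))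

end Lines

/-! ### `o`-heavy pairs of the original graph inside lines of the closure -/

namespace ClosurePair

variable [Fintype V] {G H : SimpleGraph V} {Q X : Set V}

theorem adj_of_isOHeavyPair (h : ClosurePair G H) {u v : V} (huv : IsOHeavyPair G u v) :
    H.Adj u v := by
  by_contra hn
  exact h.noHeavy u v (huv.mono h.le hn)

theorem apart (h : ClosurePair G H) {u v : V} (huv : ¬ H.Adj u v) : Apart G u v :=
  ⟨fun hh => huv (h.le hh), fun hh => huv (h.adj_of_isOHeavyPair hh)⟩

theorem exists_nbr (h : ClosurePair G H) (hQ : IsLine H Q) {a v : V} (ha : a ∈ Q) (hv : v ∈ Q)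
    (hva : v ≠ a) : ∃ b ∈ Q, G.Adj a b := by
  obtain ⟨s, -, hs, -, t, ht, -, -, hst⟩ := h.linked Q hQ ∅ {a} Set.subsingleton_empty a ha rfl
    (Set.notMem_empty _) v hv hva (Set.notMem_empty _)
  rw [Set.mem_singleton_iff] at hs
  exact ⟨t, ht, hs ▸ hst⟩

theorem exists_nbr_ne (h : ClosurePair G H) (hQ : IsLine H Q) {a v c : V} (ha : a ∈ Q) (hv : v ∈ Q)
    (hva : v ≠ a) (hvc : v ≠ c) (hac : a ≠ c) : ∃ b ∈ Q, b ≠ c ∧ G.Adj a b := by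
  obtain ⟨s, -, hs, -, t, ht, -, htc, hst⟩ := h.linked Q hQ {c} {a} Set.subsingleton_singleton a ha
    rfl hac v hv hva hvc
  rw [Set.mem_singleton_iff] at hs
  exact ⟨t, ht, htc, hs ▸ hst⟩

/-- The `G`-neighbours in the line `Q` of a vertex of `Q` with a neighbour outside `Q` are pairwise
adjacent or `o`-heavy. -/
theorem adj_or_isOHeavyPair (h : ClosurePair G H) (hQ : IsLine H Q) {a b u v : V} (ha : a ∈ Q)
    (hb : b ∉ Q) (hab : H.Adj a b) (hu : u ∈ Q) (hv : v ∈ Q) (hau : G.Adj a u) (hav : G.Adj a v)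
    (huv : u ≠ v) : G.Adj u v ∨ IsOHeavyPair G u v := by
  by_contra! hcon
  obtain ⟨X, hX, haX, hbX⟩ := h.diamond.exists_isLine hab
  -- A `G`-neighbour of `a` on its second line serves as the third leaf of a claw centred at `a`.
  obtain ⟨c, hc, hac⟩ := h.exists_nbr hX haX hbX hab.ne'
  have hcQ : c ∉ Q := fun hcQ => hb (hX.subset hQ haX hc ha hcQ hac.ne hbX)
  have hcu : ∀ u ∈ Q, G.Adj a u → ¬ H.Adj c u := fun u hu hau hcu =>
    hcQ (hQ.2 a ha u hu hau.ne c (h.le hac.symm) hcu)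
  rcases h.clawG a u v c hau hav hac huv (fun e => hcQ (e ▸ hv)) (fun e => hcQ (e ▸ hu)) hcon.1
    (fun hh => hcu v hv hav (h.le hh.symm)) (fun hh => hcu u hu hau (h.le hh.symm)) with hh | hh | hh
  · exact hcon.2 hh
  · exact hcu v hv hav (h.adj_of_isOHeavyPair hh).symm
  · exact hcu u hu hau (h.adj_of_isOHeavyPair hh).symm

/-- An `o`-heavy pair of `G` in a line has a common neighbour whose neighbourhood is in the line. -/
theorem exists_leaf (h : ClosurePair G H) (hQ : IsLine H Q) {u v : V} (hu : u ∈ Q) (hv : v ∈ Q)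
    (huv : IsOHeavyPair G u v) :
    ∃ w ∈ Q, G.Adj u w ∧ G.Adj v w ∧ ∀ x, H.Adj w x → x ∈ Q := by
  -- Counting with `φ` an outside neighbour: it is injective, since a vertex outside `Q` sees at
  -- most one vertex of `Q`.
  have hφ : ∀ w, ∃ t, (∃ t, H.Adj w t ∧ t ∉ Q) → H.Adj w t ∧ t ∉ Q := fun w => by
    by_cases hw : ∃ t, H.Adj w t ∧ t ∉ Q
    · obtain ⟨t, ht⟩ := hw
      exact ⟨t, fun _ => ht⟩
    · exact ⟨w, fun hh => absurd hh hw⟩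
  choose φ hφ using hφ
  have hwQ : ∀ w, G.Adj u w → G.Adj v w → w ∈ Q := fun w h1 h2 =>
    hQ.2 u hu v hv huv.1 w (h.le h1.symm) (h.le h2.symm)
  have hout : ∀ w x, w ∈ Q → x ∈ Q → G.Adj x w → (∃ t, H.Adj w t ∧ t ∉ Q) → ¬ G.Adj x (φ w) :=
    fun w x hw hx hxw hP hh =>
      (hφ w hP).2 (hQ.2 w hw x hx hxw.ne' _ (hφ w hP).1.symm (h.le hh.symm))
  obtain ⟨w, h1, h2, h3⟩ := exists_common_nbr_not huv.2.2 (fun w => ∃ t, H.Adj w t ∧ t ∉ Q) φ u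
    (G.loopless.irrefl u) (fun hh => huv.2.1 hh.symm)
    (fun w h1 h2 hP => ⟨hout w u (hwQ w h1 h2) hu h1 hP, hout w v (hwQ w h1 h2) hv h2 hP,
      fun e => (hφ w hP).2 (e ▸ hu)⟩)
    (fun w w' h1 h2 hP h1' h2' hP' he => hQ.unique (hwQ w h1 h2) (hwQ w' h1' h2') (hφ w hP).2
      (hφ w hP).1.symm (he ▸ (hφ w' hP').1.symm))
  push Not at h3
  exact ⟨w, hwQ w h1 h2, h1, h2, h3⟩

/-- Without neighbours outside `Q` the degree is at most `|Q| - 1`, and every vertex of the clique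
`Q` reaches that. -/
theorem deg_leaf_le (hQ : IsLine H Q) {v a : V} (hv : v ∈ Q) (ha : a ∈ Q)
    (hleaf : ∀ x, H.Adj v x → x ∈ Q) : deg H v ≤ deg H a := by
  have h1 : deg H v ≤ (Q \ {v}).ncard := by
    rw [deg_eq_ncard]
    exact Set.ncard_le_ncard (fun x hx => ⟨hleaf x hx, fun e => H.ne_of_adj hx e.symm⟩)
      (Set.toFinite _)
  have h2 : (Q \ {a}).ncard ≤ deg H a := by
    rw [deg_eq_ncard]
    exact Set.ncard_le_ncard (fun x hx => hQ.1 a ha x hx.1 fun e => hx.2 e.symm) (Set.toFinite _)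
  have h3 : (Q \ {v}).ncard + 1 = (Q \ {a}).ncard + 1 := by
    rw [Set.ncard_sdiff_singleton_add_one hv (Set.toFinite _),
      Set.ncard_sdiff_singleton_add_one ha (Set.toFinite _)]
  omega

theorem le_of_leaf (h : ClosurePair G H) (hQ : IsLine H Q) {x v a : V} (hv : v ∈ Q) (ha : a ∈ Q)
    (hleaf : ∀ x, H.Adj v x → x ∈ Q) (hxv : IsOHeavyPair G x v) :
    Fintype.card V ≤ deg H x + deg H a :=
  hxv.2.2.trans (add_le_add (deg_mono h.le x) ((deg_mono h.le v).trans (deg_leaf_le hQ hv ha hleaf)))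

/-- Two disjoint lines do not both contain an `o`-heavy pair of `G`. -/
theorem not_heavy_disjoint (h : ClosurePair G H) (hQ : IsLine H Q) (hX : IsLine H X)
    (hdis : ∀ x ∈ Q, x ∉ X) {s t s' t' : V} (hs : s ∈ Q) (ht : t ∈ Q) (hs' : s' ∈ X) (ht' : t' ∈ X)
    (h1 : IsOHeavyPair G s t) (h2 : IsOHeavyPair G s' t') : False := by
  have key : ∀ x ∈ Q, ∀ y ∈ X, Fintype.card V ≤ deg H x + deg H y → H.Adj x y :=
    fun x hx y hy hle => by
      by_contra hn
      exact h.noHeavy x y ⟨fun e => hdis x hx (e ▸ hy), hn, hle⟩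
  have e1 := h1.2.2.trans (add_le_add (deg_mono h.le s) (deg_mono h.le t))
  have e2 := h2.2.2.trans (add_le_add (deg_mono h.le s') (deg_mono h.le t'))
  have hX1 : ∀ x ∈ Q, ¬ (H.Adj x s' ∧ H.Adj x t') := fun x hx hh =>
    hdis x hx (hX.2 s' hs' t' ht' h2.1 x hh.1 hh.2)
  have hQ1 : ∀ y ∈ X, ¬ (H.Adj s y ∧ H.Adj t y) := fun y hy hh =>
    hdis y (hQ.2 s hs t ht h1.1 y hh.1.symm hh.2.symm) hy
  -- The four degrees add up to at least `2n`, so each perfect matching between the two pairs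
  -- contains a pair of degree sum at least `n`, which must be an edge of `H`. Two such edges give a
  -- vertex two neighbours on the other line.
  have c1 : H.Adj s s' ∨ H.Adj t t' := by
    by_cases hle : Fintype.card V ≤ deg H s + deg H s'
    · exact Or.inl (key s hs s' hs' hle)
    · exact Or.inr (key t ht t' ht' (by omega))
  have c2 : H.Adj s t' ∨ H.Adj t s' := by
    by_cases hle : Fintype.card V ≤ deg H s + deg H t'
    · exact Or.inl (key s hs t' ht' hle)
    · exact Or.inr (key t ht s' hs' (by omega))
  rcases c1 with c1 | c1 <;> rcases c2 with c2 | c2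
  · exact hX1 s hs ⟨c1, c2⟩
  · exact hQ1 s' hs' ⟨c1, c2⟩
  · exact hQ1 t' ht' ⟨c2, c1⟩
  · exact hX1 t ht ⟨c2, c1⟩

end ClosurePair

/-! ### Nets that are not `p`-heavy and their legs -/

/-- An induced net of `H`, not `p`-heavy, together with the line `K` of its triangle and the lines
`L i` of its pendant edges `a i b i`. -/
structure NetConfig [Fintype V] (G H : SimpleGraph V) (K : Set V) (L : Fin 3 → Set V)
    (a b : Fin 3 → V) : Prop where
  pair : ClosurePair G H
  lineK : IsLine H K
  lineL : ∀ i, IsLine H (L i)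
  aK : ∀ i, a i ∈ K
  aL : ∀ i, a i ∈ L i
  bL : ∀ i, b i ∈ L i
  bK : ∀ i, b i ∉ K
  inj : ∀ i j, i ≠ j → a i ≠ a j
  bb : ∀ i j, i ≠ j → ¬ H.Adj (b i) (b j)
  np : ∀ i j, i ≠ j → deg H (a i) + deg H (a j) < Fintype.card V

theorem exists_others (k : Fin 3) : ∃ i j : Fin 3, i ≠ j ∧ i ≠ k ∧ j ≠ k := by
  fin_cases k
  · exact ⟨1, 2, by decide⟩
  · exact ⟨0, 2, by decide⟩
  · exact ⟨0, 1, by decide⟩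

theorem exists_third : ∀ i j : Fin 3, ∃ k : Fin 3, k ≠ i ∧ k ≠ j := by
  decide

namespace NetConfig

variable [Fintype V] {G H : SimpleGraph V} {K : Set V} {L : Fin 3 → Set V} {a b : Fin 3 → V}

theorem eq_of_mem (N : NetConfig G H K L a b) {i : Fin 3} {x : V} (hx : x ∈ L i) (hxK : x ∈ K) :
    x = a i := by
  by_contra hne
  exact N.bK i ((N.lineL i).subset N.lineK hx (N.aL i) hxK (N.aK i) hne (N.bL i))

theorem b_ne (N : NetConfig G H K L a b) (i : Fin 3) : b i ≠ a i :=
  fun e => N.bK i (e ▸ N.aK i)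

theorem notMem_K (N : NetConfig G H K L a b) {i : Fin 3} {x : V} (hx : x ∈ L i) (hxa : x ≠ a i) :
    x ∉ K :=
  fun hxK => hxa (N.eq_of_mem hx hxK)

theorem adj_a (N : NetConfig G H K L a b) {i : Fin 3} {x : V} (hx : x ∈ L i) (hxa : x ≠ a i) :
    H.Adj x (a i) :=
  (N.lineL i).1 x hx _ (N.aL i) hxa

/-- The vertices of a leg are adjacent to no vertex of `K` but the root of the leg. -/
theorem not_adj_K (N : NetConfig G H K L a b) {i : Fin 3} {x y : V} (hx : x ∈ L i) (hxa : x ≠ a i)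
    (hy : y ∈ K) (hya : y ≠ a i) : ¬ H.Adj x y := fun h =>
  hya (N.lineK.unique hy (N.aK i) (N.notMem_K hx hxa) h (N.adj_a hx hxa))

theorem not_adj_a (N : NetConfig G H K L a b) {i j : Fin 3} (hij : i ≠ j) {x : V} (hx : x ∈ L i)
    (hxa : x ≠ a i) : ¬ H.Adj x (a j) :=
  N.not_adj_K hx hxa (N.aK j) (N.inj j i hij.symm)

theorem disjoint (N : NetConfig G H K L a b) {i j : Fin 3} (hij : i ≠ j) {x : V} (hx : x ∈ L i) :
    x ∉ L j := by
  intro hxj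
  by_cases hxa : x = a i
  · subst hxa
    exact N.inj i j hij (N.eq_of_mem hxj (N.aK i))
  · by_cases hxa' : x = a j
    · exact N.notMem_K hx hxa (hxa' ▸ N.aK j)
    · exact N.not_adj_a hij hx hxa (N.adj_a hxj hxa')

/-- This supplies pendant vertices for woundeds. If it failed, `s` would see `b m` for both other
legs: either `b m` is a `G`-neighbour of `a m`, or `a m` has two `G`-neighbours in `L m`, and seeing
both puts `s` on `L m`. Then `s` centres a claw with leaves `b i`, `b j`, `a k`. -/
theorem exists_pendant (N : NetConfig G H K L a b) (k : Fin 3) {s : V} (hs : s ∈ L k)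
    (hsa : s ≠ a k) : ∃ m, m ≠ k ∧ ∃ c ∈ L m, G.Adj (a m) c ∧ ¬ H.Adj s c := by
  by_contra! hcon
  have key : ∀ m, m ≠ k → H.Adj s (b m) := by
    intro m hm
    obtain ⟨c, hc, hac⟩ := N.pair.exists_nbr (N.lineL m) (N.aL m) (N.bL m) (N.b_ne m)
    by_cases hcb : c = b m
    · exact hcb ▸ hcon m hm c hc hac
    · obtain ⟨c', hc', hne, hac'⟩ := N.pair.exists_nbr_ne (N.lineL m) (N.aL m) (N.bL m) (N.b_ne m)
        (Ne.symm hcb) hac.ne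
      exact absurd ((N.lineL m).2 c hc c' hc' hne.symm s (hcon m hm c hc hac)
        (hcon m hm c' hc' hac')) (N.disjoint hm.symm hs)
  obtain ⟨i, j, hij, hik, hjk⟩ := exists_others k
  have hbi := N.not_adj_a hik (N.bL i) (N.b_ne i)
  have hbj := N.not_adj_a hjk (N.bL j) (N.b_ne j)
  rcases N.pair.claw s (b i) (b j) (a k) (key i hik) (key j hjk) (N.adj_a hs hsa)
    (fun e => N.disjoint hij (N.bL i) (e ▸ N.bL j)) (fun e => N.bK j (e ▸ N.aK k))
    (fun e => N.bK i (e ▸ N.aK k)) with h | h | h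
  · exact N.bb i j hij h
  · exact hbj h
  · exact hbi h

/-! ### The core of `K`, and the net's triangle in `G` -/

/-- The vertices of `K` that are not heavy in `G`, and the triangle of the net. -/
def core (G : SimpleGraph V) (K : Set V) (a : Fin 3 → V) : Set V :=
  {v | v ∈ K ∧ (¬ IsHeavy G v ∨ v ∈ Set.range a)}

theorem heavy_unique (N : NetConfig G H K L a b) {i j : Fin 3} (hi : IsHeavy G (a i))
    (hj : IsHeavy G (a j)) : i = j := by
  by_contra hij
  have h1 := N.np i j hij
  have h2 := deg_mono N.pair.le (a i)
  have h3 := deg_mono N.pair.le (a j)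
  unfold IsHeavy at hi hj
  omega

theorem exists_not_heavy (N : NetConfig G H K L a b) : ∃ i, ¬ IsHeavy G (a i) := by
  by_contra! hcon
  exact absurd (N.heavy_unique (hcon 0) (hcon 1)) (by decide)

theorem exists_outside (N : NetConfig G H K L a b) {v : V} (hv : v ∈ K) (hh : IsHeavy G v) :
    ∃ x, H.Adj v x ∧ x ∉ K := by
  by_contra! hcon
  have h1 := ClosurePair.deg_leaf_le N.lineK hv (N.aK 0) hcon
  have h2 := ClosurePair.deg_leaf_le N.lineK hv (N.aK 1) hcon
  have h3 := N.np 0 1 (by decide)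
  have h4 := deg_mono N.pair.le v
  unfold IsHeavy at hh
  omega

/-- Each heavy vertex of `K` has a neighbour outside `K`, shared with no other vertex of `K`. The
extra vertex of the count is `b i` over a corner that is not heavy, which no heavy vertex of `K`
sees. -/
theorem not_heavy_common (N : NetConfig G H K L a b) {f f' : V} (hf : f ∈ K) (hf' : f' ∈ K)
    (hne : f ≠ f') (hh : IsHeavy G f) (hh' : IsHeavy G f') :
    ∃ w ∈ K, G.Adj f w ∧ G.Adj f' w ∧ ¬ IsHeavy G w := by
  obtain ⟨i, hi⟩ := N.exists_not_heavy
  have hφ : ∀ w, ∃ t, w ∈ K → IsHeavy G w → H.Adj w t ∧ t ∉ K := fun w => by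
    by_cases hw : w ∈ K ∧ IsHeavy G w
    · obtain ⟨t, ht⟩ := N.exists_outside hw.1 hw.2
      exact ⟨t, fun _ _ => ht⟩
    · exact ⟨w, fun h1 h2 => absurd ⟨h1, h2⟩ hw⟩
  choose φ hφ using hφ
  have hwK : ∀ w, G.Adj f w → G.Adj f' w → w ∈ K := fun w h1 h2 =>
    N.lineK.2 f hf f' hf' hne w (N.pair.le h1.symm) (N.pair.le h2.symm)
  have hb : ∀ x ∈ K, IsHeavy G x → ¬ H.Adj (b i) x := fun x hx hxh =>
    N.not_adj_K (N.bL i) (N.b_ne i) hx fun e => hi (e ▸ hxh)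
  have hout : ∀ w x, w ∈ K → x ∈ K → G.Adj x w → IsHeavy G w → ¬ G.Adj x (φ w) :=
    fun w x hw hx hxw hP hh => hxw.ne
      (N.lineK.unique hx hw (hφ w hw hP).2 (N.pair.le hh.symm) (hφ w hw hP).1.symm)
  have hn : Fintype.card V ≤ deg G f + deg G f' := by
    unfold IsHeavy at hh hh'
    omega
  obtain ⟨w, h1, h2, h3⟩ := exists_common_nbr_not hn (IsHeavy G) φ (b i)
    (fun e => hb f hf hh (N.pair.le e.symm)) (fun e => hb f' hf' hh' (N.pair.le e.symm))
    (fun w h1 h2 hP => ⟨hout w f (hwK w h1 h2) hf h1 hP, hout w f' (hwK w h1 h2) hf' h2 hP,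
      fun e => hb w (hwK w h1 h2) hP (e ▸ (hφ w (hwK w h1 h2) hP).1.symm)⟩)
    (fun w w' h1 h2 hP h1' h2' hP' he => N.lineK.unique (hwK w h1 h2) (hwK w' h1' h2')
      (hφ w (hwK w h1 h2) hP).2 (hφ w (hwK w h1 h2) hP).1.symm
      (he ▸ (hφ w' (hwK w' h1' h2') hP').1.symm))
  exact ⟨w, hwK w h1 h2, h1, h2, h3⟩

/-- The graph `G` restricted to the core of `K`. -/
def coreGraph (G : SimpleGraph V) (K : Set V) (a : Fin 3 → V) : SimpleGraph V where
  Adj u v := G.Adj u v ∧ u ∈ core G K a ∧ v ∈ core G K a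
  symm := ⟨fun _ _ h => ⟨h.1.symm, h.2.2, h.2.1⟩⟩
  loopless := ⟨fun u h => G.loopless.irrefl u h.1⟩

theorem a_mem_core (N : NetConfig G H K L a b) (i : Fin 3) : a i ∈ core G K a :=
  ⟨N.aK i, Or.inr ⟨i, rfl⟩⟩

/-- Heavy vertices can be bypassed. The non-heavy `G`-neighbours in `K` of one heavy vertex are
pairwise adjacent, because two non-heavy vertices never form an `o`-heavy pair; and two heavy
vertices have a non-heavy common neighbour. -/
theorem coreGraph_reachable (N : NetConfig G H K L a b) {u v : V} (hu : u ∈ core G K a)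
    (hv : v ∈ core G K a) : (coreGraph G K a).Reachable u v := by
  set J := coreGraph G K a
  have hJ : ∀ s t, s ∈ K → t ∈ K → ¬ IsHeavy G s → ¬ IsHeavy G t → G.Adj s t → J.Reachable s t :=
    fun s t hs ht hsh hth hst =>
      SimpleGraph.Adj.reachable ⟨hst, ⟨hs, Or.inl hsh⟩, ⟨ht, Or.inl hth⟩⟩
  have h1 : ∀ f s s', f ∈ K → IsHeavy G f → s ∈ K → s' ∈ K → ¬ IsHeavy G s → ¬ IsHeavy G s' →
      G.Adj f s → G.Adj f s' → J.Reachable s s' := by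
    intro f s s' hf hfh hs hs' hsh hsh' hfs hfs'
    by_cases hne : s = s'
    · subst hne; exact SimpleGraph.Reachable.refl _
    obtain ⟨x, hx, hxK⟩ := N.exists_outside hf hfh
    rcases N.pair.adj_or_isOHeavyPair N.lineK hf hxK hx hs hs' hfs hfs' hne with h | h
    · exact hJ s s' hs hs' hsh hsh' h
    · have := h.2.2
      unfold IsHeavy at hsh hsh'
      omega
  have h2 : ∀ f f' s s', f ∈ K → IsHeavy G f → f' ∈ K → IsHeavy G f' → s ∈ K → s' ∈ K →
      ¬ IsHeavy G s → ¬ IsHeavy G s' → G.Adj f s → G.Adj f' s' → J.Reachable s s' := by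
    intro f f' s s' hf hfh hf' hfh' hs hs' hsh hsh' hfs hfs'
    by_cases hne : f = f'
    · subst hne; exact h1 f s s' hf hfh hs hs' hsh hsh' hfs hfs'
    obtain ⟨w, hw, hfw, hfw', hwh⟩ := N.not_heavy_common hf hf' hne hfh hfh'
    exact (h1 f s w hf hfh hs hw hsh hwh hfs hfw).trans
      (h1 f' w s' hf' hfh' hw hs' hwh hsh' hfw' hfs')
  have h3 : ∀ x ∈ K, ¬ IsHeavy G x → ∀ y ∈ K, ¬ (¬ IsHeavy G y ∧ J.Reachable x y) →
      ∃ s ∈ K, ¬ IsHeavy G s ∧ J.Reachable x s ∧ ∃ f ∈ K, IsHeavy G f ∧ G.Adj f s := by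
    intro x hx hxh y hy hyx
    obtain ⟨s, hs, ⟨hsh, hxs⟩, -, t, ht, htS, -, hst⟩ := N.pair.linked K N.lineK ∅
      {w | ¬ IsHeavy G w ∧ J.Reachable x w} Set.subsingleton_empty x hx
      ⟨hxh, SimpleGraph.Reachable.refl _⟩ (Set.notMem_empty _) y hy hyx (Set.notMem_empty _)
    refine ⟨s, hs, hsh, hxs, t, ht, ?_, hst.symm⟩
    by_contra hth
    exact htS ⟨hth, hxs.trans (hJ s t hs ht hsh hth hst)⟩
  have h4 : ∀ x ∈ K, ∀ y ∈ K, ¬ IsHeavy G x → ¬ IsHeavy G y → J.Reachable x y := by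
    intro x hx y hy hxh hyh
    by_contra hxy
    obtain ⟨s, hs, hsh, hxs, f, hf, hfh, hfs⟩ := h3 x hx hxh y hy fun h => hxy h.2
    obtain ⟨s', hs', hsh', hxs', f', hf', hfh', hfs'⟩ := h3 y hy hyh x hx fun h => hxy h.2.symm
    exact hxy ((hxs.trans (h2 f f' s s' hf hfh hf' hfh' hs hs' hsh hsh' hfs hfs')).trans hxs'.symm)
  have h5 : ∀ x ∈ core G K a, ∃ s ∈ K, ¬ IsHeavy G s ∧ J.Reachable x s := by
    intro x hx
    by_cases hxh : IsHeavy G x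
    · have h6 : ∃ s ∈ K, ¬ IsHeavy G s ∧ G.Adj x s := by
        by_cases hf : ∃ f ∈ K, f ≠ x ∧ IsHeavy G f
        · obtain ⟨f, hf, hfx, hfh⟩ := hf
          obtain ⟨w, hw, hxw, -, hwh⟩ := N.not_heavy_common hx.1 hf hfx.symm hxh hfh
          exact ⟨w, hw, hwh, hxw⟩
        · push Not at hf
          have : ∃ i, a i ≠ x := by
            by_contra! hcon
            exact N.inj 0 1 (by decide) ((hcon 0).trans (hcon 1).symm)
          obtain ⟨i, hi⟩ := this
          obtain ⟨s, hs, hxs⟩ := N.pair.exists_nbr N.lineK hx.1 (N.aK i) hi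
          exact ⟨s, hs, hf s hs hxs.ne', hxs⟩
      obtain ⟨s, hs, hsh, hxs⟩ := h6
      exact ⟨s, hs, hsh, SimpleGraph.Adj.reachable ⟨hxs, hx, ⟨hs, Or.inl hsh⟩⟩⟩
    · exact ⟨x, hx.1, hxh, SimpleGraph.Reachable.refl _⟩
  obtain ⟨s, hs, hsh, hus⟩ := h5 u hu
  obtain ⟨s', hs', hsh', hvs'⟩ := h5 v hv
  exact (hus.trans (h4 s hs s' hs' hsh hsh')).trans hvs'.symm

/-- As `y` is not heavy, `z` is the only heavy corner. Moreover `y` has a neighbour outside `K`, for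
otherwise `le_of_leaf` makes the net `p`-heavy. So nonadjacent core neighbours of `y` would be
`o`-heavy; but none of them is heavy, since `z` is not adjacent to `y`. -/
theorem core_adj_of_isOHeavyPair (N : NetConfig G H K L a b) {y z s s' : V} (hy : y ∈ core G K a)
    (hz : z ∈ core G K a) (hya : y ∉ Set.range a) (hyz : IsOHeavyPair G y z) (hs : s ∈ core G K a)
    (hs' : s' ∈ core G K a) (hys : G.Adj y s) (hys' : G.Adj y s') (hne : s ≠ s') :
    G.Adj s s' := by
  have hyh : ¬ IsHeavy G y := hy.2.resolve_right hya
  have hzh : IsHeavy G z := by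
    have := hyz.2.2
    unfold IsHeavy at hyh ⊢
    omega
  obtain ⟨m, rfl⟩ := hz.2.resolve_left fun h => h hzh
  have hout : ∃ x, H.Adj y x ∧ x ∉ K := by
    by_contra! hleaf
    obtain ⟨j, -, -, hj, -⟩ := exists_others m
    exact absurd (N.pair.le_of_leaf N.lineK hy.1 (N.aK j) hleaf hyz.symm)
      (not_le.2 (N.np m j hj.symm))
  obtain ⟨x, hx, hxK⟩ := hout
  refine (N.pair.adj_or_isOHeavyPair N.lineK hy.1 hxK hx hs.1 hs'.1 hys hys' hne).resolve_right
    fun h => ?_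
  have hlight : ∀ w, w ∈ core G K a → G.Adj y w → ¬ IsHeavy G w := by
    intro w hw hyw hwh
    obtain ⟨l, rfl⟩ := hw.2.resolve_left fun h => h hwh
    rw [N.heavy_unique hwh hzh] at hyw
    exact hyz.2.1 hyw
  have h1 := hlight s hs hys
  have h2 := hlight s' hs' hys'
  have h3 := h.2.2
  unfold IsHeavy at h1 h2
  omega

/-- A vertex of the net's triangle, or a vertex with two nonadjacent neighbours in the core. -/
def Good (G : SimpleGraph V) (K : Set V) (a : Fin 3 → V) (y : V) : Prop :=
  y ∈ core G K a ∧ (y ∈ Set.range a ∨ ∃ s ∈ core G K a, ∃ s' ∈ core G K a,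
    G.Adj y s ∧ G.Adj y s' ∧ s ≠ s' ∧ ¬ G.Adj s s')

theorem Good.not_isOHeavyPair (N : NetConfig G H K L a b) {y z : V} (hy : Good G K a y)
    (hz : Good G K a z) : ¬ IsOHeavyPair G y z := by
  intro h
  by_cases hya : y ∈ Set.range a
  · by_cases hza : z ∈ Set.range a
    · obtain ⟨i, rfl⟩ := hya
      obtain ⟨j, rfl⟩ := hza
      have h1 := N.np i j fun e => h.1 (by rw [e])
      have h2 := deg_mono N.pair.le (a i)
      have h3 := deg_mono N.pair.le (a j)
      have h4 := h.2.2
      omega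
    · obtain ⟨s, hs, s', hs', h1, h2, h3, h4⟩ := hz.2.resolve_left hza
      exact h4 (N.core_adj_of_isOHeavyPair hz.1 hy.1 hza h.symm hs hs' h1 h2 h3)
  · obtain ⟨s, hs, s', hs', h1, h2, h3, h4⟩ := hy.2.resolve_left hya
    exact h4 (N.core_adj_of_isOHeavyPair hy.1 hz.1 hya h hs hs' h1 h2 h3)

/-- Distance functions of the core to the vertices of the triangle. -/
structure CoreDist (G : SimpleGraph V) (K : Set V) (a : Fin 3 → V) (d : Fin 3 → V → ℕ) : Prop where
  zero : ∀ i, d i (a i) = 0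
  step : ∀ i, ∀ u ∈ core G K a, ∀ w ∈ core G K a, G.Adj u w → d i u ≤ d i w + 1
  next : ∀ i, ∀ v ∈ core G K a, v ≠ a i → ∃ w ∈ core G K a, G.Adj v w ∧ d i w + 1 = d i v

theorem exists_coreDist (N : NetConfig G H K L a b) : ∃ d, CoreDist G K a d := by
  refine ⟨fun i v => (coreGraph G K a).dist v (a i), ?_, ?_, ?_⟩
  · intro i
    exact SimpleGraph.dist_self
  · intro i u hu w hw huw
    obtain ⟨p, hp⟩ := (N.coreGraph_reachable hw (N.a_mem_core i)).exists_walk_length_eq_dist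
    have hadj : (coreGraph G K a).Adj u w := ⟨huw, hu, hw⟩
    have := SimpleGraph.dist_le (SimpleGraph.Walk.cons hadj p)
    rwa [SimpleGraph.Walk.length_cons, hp] at this
  · intro i v hv hne
    obtain ⟨p, hp⟩ := (N.coreGraph_reachable hv (N.a_mem_core i)).exists_walk_length_eq_dist
    cases p with
    | nil => exact absurd rfl hne
    | @cons _ w _ h q =>
      refine ⟨w, h.2.2, h.1, ?_⟩
      have h1 := SimpleGraph.dist_le q
      obtain ⟨q', hq'⟩ :=
        (N.coreGraph_reachable h.2.2 (N.a_mem_core i)).exists_walk_length_eq_dist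
      have h2 := SimpleGraph.dist_le (SimpleGraph.Walk.cons h q')
      rw [SimpleGraph.Walk.length_cons] at hp h2
      show _ + 1 = _
      omega

/-- A core vertex minimising the sum of the distances to the triangle is in the triangle. -/
theorem mem_range_of_minimal (N : NetConfig G H K L a b) {d : Fin 3 → V → ℕ}
    (D : CoreDist G K a d) {t : V} (ht : t ∈ core G K a)
    (hmin : ∀ v ∈ core G K a, ∀ i j k : Fin 3, i ≠ j → i ≠ k → j ≠ k →
      d i t + d j t + d k t ≤ d i v + d j v + d k v) : t ∈ Set.range a := by
  by_contra hta
  have hne : ∀ i, t ≠ a i := fun i e => hta ⟨i, e.symm⟩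
  -- `T i` is the first step of a shortest path from `t` to the corner `a i`.
  have hT : ∀ i, ∃ w ∈ core G K a, G.Adj t w ∧ d i w + 1 = d i t := fun i =>
    D.next i t ht (hne i)
  choose T hTc hTt hTd using hT
  have hup : ∀ m, ∀ v ∈ core G K a, G.Adj v t → d m v ≤ d m t + 1 := fun m v hv hvt =>
    D.step m v hv t ht hvt
  have hTne : ∀ i j, i ≠ j → T i ≠ T j := by
    intro i j hij e
    obtain ⟨k, hki, hkj⟩ : ∃ k : Fin 3, k ≠ i ∧ k ≠ j := exists_third i j
    have h1 := hmin (T i) (hTc i) i j k hij hki.symm hkj.symm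
    have h2 := hTd i
    have h3 := hTd j
    have h4 := hup k (T i) (hTc i) (hTt i).symm
    rw [← e] at h3
    omega
  -- vertices at distance two less
  have hfar : ∀ m, ∀ x ∈ core G K a, d m x + 2 = d m t → ¬ G.Adj x t ∧ x ≠ t := by
    intro m x hx hxd
    refine ⟨fun h => ?_, fun e => ?_⟩
    · have := D.step m t ht x hx h.symm
      omega
    · subst e
      omega
  have hgoodT : ∀ m, Good G K a (T m) := by
    intro m
    refine ⟨hTc m, ?_⟩
    by_cases h : T m = a m
    · exact Or.inl ⟨m, h.symm⟩
    · obtain ⟨x, hx, hTx, hxd⟩ := D.next m (T m) (hTc m) h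
      have := hfar m x hx (by rw [← hTd m]; omega)
      exact Or.inr ⟨x, hx, t, ht, hTx, (hTt m).symm, this.2, this.1⟩
  have hgoodx : ∀ m, ∀ x ∈ core G K a, G.Adj (T m) x → d m x + 2 = d m t → Good G K a x := by
    intro m x hx hTx hxd
    refine ⟨hx, ?_⟩
    by_cases h : x = a m
    · exact Or.inl ⟨m, h.symm⟩
    · obtain ⟨y, hy, hxy, hyd⟩ := D.next m x hx h
      have h1 : ¬ G.Adj y (T m) := fun hh => by
        have := D.step m (T m) (hTc m) y hy hh.symm
        have := hTd m
        omega
      refine Or.inr ⟨y, hy, T m, hTc m, hxy, hTx.symm, fun e => ?_, h1⟩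
      have := hTd m
      rw [e] at hyd
      omega
  -- two of the three neighbours are adjacent
  have hadj : ∃ i j, i ≠ j ∧ G.Adj (T i) (T j) := by
    by_contra! hcon
    rcases N.pair.clawG t (T 0) (T 1) (T 2) (hTt 0) (hTt 1) (hTt 2) (hTne 0 1 (by decide))
      (hTne 1 2 (by decide)) (hTne 0 2 (by decide)) (hcon 0 1 (by decide)) (hcon 1 2 (by decide))
      (hcon 0 2 (by decide)) with h | h | h
    · exact (hgoodT 0).not_isOHeavyPair N (hgoodT 1) h
    · exact (hgoodT 1).not_isOHeavyPair N (hgoodT 2) h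
    · exact (hgoodT 0).not_isOHeavyPair N (hgoodT 2) h
  obtain ⟨i, j, hij, hTij⟩ := hadj
  obtain ⟨k, hki, hkj⟩ : ∃ k : Fin 3, k ≠ i ∧ k ≠ j := exists_third i j
  -- If `T i` saw both `T j` and `T k`, it would be nearer to `a i` and no farther from the other
  -- corners, against minimality of `t`.
  have hTk : ∀ i j, i ≠ j → k ≠ i → k ≠ j → G.Adj (T i) (T j) → ¬ G.Adj (T k) (T i) := by
    intro i j hij hki hkj hTij h
    have h1 := hmin (T i) (hTc i) i j k hij hki.symm hkj.symm
    have h2 := hTd i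
    have h3 := D.step j (T i) (hTc i) (T j) (hTc j) hTij
    have h4 := D.step k (T i) (hTc i) (T k) (hTc k) h.symm
    have h5 := hTd j
    have h6 := hTd k
    omega
  have hki' := hTk i j hij hki hkj hTij
  have hkj' := hTk j i hij.symm hkj hki hTij.symm
  have hgoodt : Good G K a t :=
    ⟨ht, Or.inr ⟨T k, hTc k, T i, hTc i, hTt k, hTt i, hTne k i hki, hki'⟩⟩
  -- the continuation of an arm, inside or outside of the core
  let Arm : Fin 3 → V → Prop := fun m p =>
    (p ∈ core G K a ∧ G.Adj (T m) p ∧ d m p + 2 = d m t) ∨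
      (T m = a m ∧ p ∈ L m ∧ G.Adj (a m) p)
  have hArmAdj : ∀ m p, Arm m p → G.Adj (T m) p := by
    rintro m p (⟨-, h, -⟩ | ⟨h, -, h'⟩)
    · exact h
    · rwa [h]
  have hArmt : ∀ m p, Arm m p → Apart G p t := by
    rintro m p (⟨hp, h1, h2⟩ | ⟨-, h2, h3⟩)
    · exact ⟨(hfar m p hp h2).1, (hgoodx m p hp h1 h2).not_isOHeavyPair N hgoodt⟩
    · exact N.pair.apart (N.not_adj_K h2 h3.ne' ht.1 (hne m))
  have hArmT : ∀ m l p, m ≠ l → Arm m p → Apart G p (T l) := by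
    rintro m l p hml (⟨hp, h1, h2⟩ | ⟨h1, h2, h3⟩)
    · refine ⟨fun h => ?_, (hgoodx m p hp h1 h2).not_isOHeavyPair N (hgoodT l)⟩
      obtain ⟨q, hqm, hql⟩ : ∃ q : Fin 3, q ≠ m ∧ q ≠ l := exists_third m l
      have e1 := hmin (T l) (hTc l) m l q hml hqm.symm hql.symm
      have e2 := D.step m (T l) (hTc l) p hp h.symm
      have e3 := hTd l
      have e4 := hup q (T l) (hTc l) (hTt l).symm
      omega
    · exact N.pair.apart (N.not_adj_K h2 h3.ne' (hTc l).1 fun e =>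
        hTne l m hml.symm (e.trans h1.symm))
  have hArm2 : ∀ m l p q, m ≠ l → Arm m p → Arm l q → (p ∈ core G K a ∨ ¬ H.Adj q p) →
      Apart G p q := by
    rintro m l p q hml hp hq hpq
    rcases hpq with hpc | hpq
    · rcases hp with ⟨-, h1, h2⟩ | ⟨-, h2, h3⟩
      · rcases hq with ⟨hqc, h1', h2'⟩ | ⟨h1', h2', h3'⟩
        · refine ⟨fun h => ?_, (hgoodx m p hpc h1 h2).not_isOHeavyPair N (hgoodx l q hqc h1' h2')⟩
          obtain ⟨r, hrm, hrl⟩ : ∃ q : Fin 3, q ≠ m ∧ q ≠ l := exists_third m l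
          have e1 := hmin q hqc m l r hml hrm.symm hrl.symm
          have e2 := D.step m q hqc p hpc h.symm
          have e3 := D.step r q hqc (T l) (hTc l) h1'.symm
          have e4 := hup r (T l) (hTc l) (hTt l).symm
          omega
        · refine (N.pair.apart (N.not_adj_K h2' h3'.ne' hpc.1 fun e => ?_)).symm
          have := (hArmt m p (Or.inl ⟨hpc, h1, h2⟩)).1
          rw [e, ← h1'] at this
          exact this (hTt l).symm
      · exact absurd hpc.1 (N.notMem_K h2 h3.ne')
    · exact (N.pair.apart hpq).symm
  have hArmEx : ∀ m, ∃ p, Arm m p ∧ (p ∈ core G K a ∨ T m = a m) := by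
    intro m
    by_cases h : T m = a m
    · obtain ⟨p, hp, hap⟩ := N.pair.exists_nbr (N.lineL m) (N.aL m) (N.bL m) (N.b_ne m)
      exact ⟨p, Or.inr ⟨h, hp, hap⟩, Or.inr h⟩
    · obtain ⟨x, hx, hTx, hxd⟩ := D.next m (T m) (hTc m) h
      exact ⟨x, Or.inl ⟨hx, hTx, by rw [← hTd m]; omega⟩, Or.inl hx⟩
  -- the wounded graph with the long path along the arm `k`
  have fin : ∀ m l p q, m ≠ l → m ≠ k → l ≠ k → G.Adj (T m) (T l) → ¬ G.Adj (T k) (T m) →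
      ¬ G.Adj (T k) (T l) → Arm m p → Arm k q → Apart G p q → False := by
    intro m l p q hml hmk hlk hTml hkm hkl hp hq hpq
    exact N.pair.wounded.no_wounded hTml.symm (hTt l).symm (hTt m).symm (hArmAdj m p hp) (hTt k)
      (hArmAdj k q hq) (hArmT m l p hml hp).symm
      ⟨fun h => hkl h.symm, (hgoodT l).not_isOHeavyPair N (hgoodT k)⟩
      (hArmT k l q hlk.symm hq).symm ⟨fun h => hkm h.symm, (hgoodT m).not_isOHeavyPair N (hgoodT k)⟩
      (hArmT k m q hmk.symm hq).symm (hArmt m p hp).symm (hArmt k q hq).symm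
      (hArmT m k p hmk hp) hpq
  by_cases hTi : T i = a i
  · by_cases hTj : T j = a j
    · obtain ⟨q, hq, -⟩ := hArmEx k
      by_cases hqc : q ∈ core G K a
      · obtain ⟨p, hp, -⟩ := hArmEx i
        exact fin i j p q hij hki.symm hkj.symm hTij hki' hkj' hp hq
          (hArm2 k i q p hki hq hp (Or.inl hqc)).symm
      · rcases hq with ⟨hqc', -⟩ | ⟨hk, hqL, hkq⟩
        · exact hqc hqc'
        -- All three arms leave the core at once, so distances no longer separate their ends;
        -- `exists_pendant` decides which of the legs `i`, `j` carries the pendant vertex.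
        obtain ⟨m, hmk, p, hp, hmp, hqp⟩ := N.exists_pendant k hqL hkq.ne'
        by_cases hmi : m = i
        · subst hmi
          exact fin m j p q hij hki.symm hkj.symm hTij hki' hkj' (Or.inr ⟨hTi, hp, hmp⟩)
            (Or.inr ⟨hk, hqL, hkq⟩) (N.pair.apart hqp).symm
        · have hmj : m = j := by omega
          subst hmj
          exact fin m i p q hij.symm hkj.symm hki.symm hTij.symm hkj' hki' (Or.inr ⟨hTj, hp, hmp⟩)
            (Or.inr ⟨hk, hqL, hkq⟩) (N.pair.apart hqp).symm
    · obtain ⟨q, hq, -⟩ := hArmEx k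
      obtain ⟨p, hp, hpc⟩ := hArmEx j
      exact fin j i p q hij.symm hkj.symm hki.symm hTij.symm hkj' hki' hp hq
        (hArm2 j k p q hkj.symm hp hq (Or.inl (hpc.resolve_right hTj)))
  · obtain ⟨q, hq, -⟩ := hArmEx k
    obtain ⟨p, hp, hpc⟩ := hArmEx i
    exact fin i j p q hij hki.symm hkj.symm hTij hki' hkj' hp hq
      (hArm2 i k p q hki.symm hp hq (Or.inl (hpc.resolve_right hTi)))

/-- The triangle of the net is a triangle of `G`. -/
theorem adj_triangle (N : NetConfig G H K L a b) {i j : Fin 3} (hij : i ≠ j) :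
    G.Adj (a i) (a j) := by
  obtain ⟨d, D⟩ := N.exists_coreDist
  obtain ⟨t, ht, hmin⟩ := Set.exists_min_image (core G K a) (fun v => d 0 v + d 1 v + d 2 v)
    (Set.toFinite _) ⟨a 0, N.a_mem_core 0⟩
  have hsum : ∀ v, ∀ i j k : Fin 3, i ≠ j → i ≠ k → j ≠ k →
      d i v + d j v + d k v = d 0 v + d 1 v + d 2 v := by
    intro v i j k hij hik hjk
    fin_cases i <;> fin_cases j <;> fin_cases k <;> simp at hij hik hjk ⊢ <;> omega
  obtain ⟨k, rfl⟩ := N.mem_range_of_minimal D ht fun v hv i j k hij hik hjk => by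
    rw [hsum _ i j k hij hik hjk, hsum _ i j k hij hik hjk]
    exact hmin v hv
  -- the neighbours towards the two other vertices
  have key : ∀ i j, i ≠ j → i ≠ k → j ≠ k → G.Adj (a k) (a i) ∧ G.Adj (a i) (a j) := by
    intro i j hij hik hjk
    obtain ⟨s, hs, hks, hsd⟩ := D.next i (a k) ht (N.inj k i hik.symm)
    obtain ⟨r, hr, hkr, hrd⟩ := D.next j (a k) ht (N.inj k j hjk.symm)
    have hk0 := D.zero k
    have hle : ∀ v ∈ core G K a, d i (a k) + d j (a k) ≤ d i v + d j v + d k v := by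
      intro v hv
      have h1 := hmin v hv
      rw [← hsum v i j k hij hik hjk, ← hsum (a k) i j k hij hik hjk] at h1
      omega
    have hup : ∀ v ∈ core G K a, G.Adj v (a k) → d k v ≤ 1 := fun v hv h => by
      have := D.step k v hv (a k) ht h
      omega
    have hsr : s ≠ r := by
      rintro rfl
      have := hle s hs
      have := hup s hs hks.symm
      omega
    have hgood : ∀ m, m ≠ k → ∀ v ∈ core G K a, G.Adj (a k) v → d m v + 1 = d m (a k) →
        Good G K a v := by
      intro m hm v hv hkv hvd
      refine ⟨hv, ?_⟩
      by_cases h : v = a m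
      · exact Or.inl ⟨m, h.symm⟩
      · obtain ⟨x, hx, hvx, hxd⟩ := D.next m v hv h
        refine Or.inr ⟨x, hx, a k, ht, hvx, hkv.symm, fun e => ?_, fun hh => ?_⟩
        · rw [e] at hxd
          omega
        · have := D.step m (a k) ht x hx hh.symm
          omega
    have hadj : G.Adj s r := by
      refine (N.pair.adj_or_isOHeavyPair N.lineK ht.1 (N.bK k)
        (N.adj_a (N.bL k) (N.b_ne k)).symm hs.1 hr.1 hks hkr hsr).resolve_right ?_
      exact (hgood i hik s hs hks hsd).not_isOHeavyPair N (hgood j hjk r hr hkr hrd)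
    -- both neighbours are minimisers
    have hmin' : ∀ i j, i ≠ j → i ≠ k → j ≠ k → (∀ v ∈ core G K a, d i (a k) + d j (a k) ≤
        d i v + d j v + d k v) → ∀ s ∈ core G K a, ∀ r ∈ core G K a, G.Adj (a k) s →
        G.Adj s r → d i s + 1 = d i (a k) → d j r + 1 = d j (a k) → s = a i := by
      intro i j hij hik hjk hle s hs r hr hks hsr hsd hrd
      -- Compared with `a k`, `s` is one nearer to `a i`, no farther from `a j` thanks to `r`, and
      -- at most one away from `a k`; so it is a minimiser too, hence a corner.
      have h1 := D.step j s hs r hr hsr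
      have h2 := hup s hs hks.symm
      obtain ⟨m, rfl⟩ := N.mem_range_of_minimal D hs fun v hv p q l hpq hpl hql => by
        have h3 := hle v hv
        have h4 := hsum s p q l hpq hpl hql
        rw [← hsum s i j k hij hik hjk] at h4
        have h5 := hsum v p q l hpq hpl hql
        rw [← hsum v i j k hij hik hjk] at h5
        omega
      by_cases hmi : m = i
      · rw [hmi]
      by_cases hmj : m = j
      · subst hmj
        have h3 := hle (a m) hs
        have h4 := D.zero m
        omega
      · have hmk : m = k := by omega
        subst hmk
        exact absurd rfl hks.ne
    have e1 := hmin' i j hij hik hjk hle s hs r hr hks hadj hsd hrd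
    have e2 := hmin' j i hij.symm hjk hik (fun v hv => by have := hle v hv; omega) r hr s hs hkr
      hadj.symm hrd hsd
    subst e1 e2
    exact ⟨hks, hadj⟩
  by_cases hik : i = k
  · subst hik
    obtain ⟨l, hli, hlj⟩ : ∃ l : Fin 3, l ≠ i ∧ l ≠ j := exists_third i j
    exact (key j l hlj.symm hij.symm hli).1
  · by_cases hjk : j = k
    · subst hjk
      obtain ⟨l, hli, hlj⟩ : ∃ l : Fin 3, l ≠ i ∧ l ≠ j := exists_third i j
      exact (key i l hli.symm hij hlj).1.symm
    · exact (key i j hij hik hjk).2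

/-! ### Edges of `G` leaving the legs -/

theorem exists_leg_nbr (N : NetConfig G H K L a b) (i : Fin 3) : ∃ c ∈ L i, G.Adj (a i) c :=
  N.pair.exists_nbr (N.lineL i) (N.aL i) (N.bL i) (N.b_ne i)

theorem exists_leg_nbr_ne (N : NetConfig G H K L a b) {i : Fin 3} {c x : V} (hx : x ∈ L i)
    (hxa : x ≠ a i) (hxc : x ≠ c) (hc : a i ≠ c) : ∃ w ∈ L i, w ≠ c ∧ G.Adj (a i) w :=
  N.pair.exists_nbr_ne (N.lineL i) (N.aL i) hx hxa hxc hc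

theorem mem_of_adj_a (N : NetConfig G H K L a b) {i : Fin 3} {v : V} (h : H.Adj (a i) v) :
    v ∈ K ∨ v ∈ L i := by
  obtain ⟨j, -, -, hj, -⟩ := exists_others i
  exact N.lineK.mem_or_mem (N.lineL i) N.pair.claw (N.aK i) (N.aK j) (N.inj j i hj) (N.aL i)
    (N.bL i) (N.bK i) h

/-- A line other than a leg meets the leg in at most one vertex. -/
theorem line_inter (N : NetConfig G H K L a b) {i : Fin 3} {X : Set V} (hX : IsLine H X) {x y z : V}
    (hxX : x ∈ X) (hx : x ∈ L i) (hyX : y ∈ X) (hy : y ∈ L i) (hzX : z ∈ X) (hz : z ∉ L i) :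
    x = y := by
  by_contra hne
  exact hz (hX.subset (N.lineL i) hxX hyX hx hy hne hzX)

/-- The neighbours of a vertex in a leg and in a further line. -/
theorem mem_of_adj_leg (N : NetConfig G H K L a b) {i : Fin 3} {X : Set V} (hX : IsLine H X)
    {x y v : V} (hx : x ∈ L i) (hxa : x ≠ a i) (hxX : x ∈ X) (hyX : y ∈ X) (hy : y ∉ L i)
    (hv : H.Adj x v) : v ∈ L i ∨ v ∈ X :=
  (N.lineL i).mem_or_mem hX N.pair.claw hx (N.aL i) hxa.symm hxX hyX hy hv

/-- The wounded on the net's triangle with pendant edge `a j c` and long path `a i p q`; only the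
pairs not settled by the position of the legs remain as hypotheses. -/
theorem wounded_leg (N : NetConfig G H K L a b) {i j k : Fin 3} (hij : i ≠ j) (hik : i ≠ k)
    (hjk : j ≠ k) {p q c : V} (hp : p ∈ L i) (hip : G.Adj (a i) p) (hpq : G.Adj p q)
    (hiq : Apart G (a i) q) (hjq : Apart G (a j) q) (hkq : Apart G (a k) q) (hc : c ∈ L j)
    (hjc : G.Adj (a j) c) (hpc : ¬ H.Adj p c) (hqc : ¬ H.Adj q c) : False :=
  N.pair.wounded.no_wounded (N.adj_triangle hjk.symm) (N.adj_triangle hik.symm)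
    (N.adj_triangle hij.symm) hjc hip hpq
    (N.pair.apart (N.not_adj_a hjk hc hjc.ne')).symm
    (N.pair.apart (N.not_adj_a hik hp hip.ne')).symm hkq
    (N.pair.apart (N.not_adj_a hij hp hip.ne')).symm hjq
    (N.pair.apart (N.not_adj_a hij.symm hc hjc.ne')).symm hiq
    (N.pair.apart hpc).symm (N.pair.apart hqc).symm

/-- The leg `L i` contains no `o`-heavy pair of `G`. -/
def LightLeg (G : SimpleGraph V) (L : Fin 3 → Set V) (i : Fin 3) : Prop :=
  ∀ s ∈ L i, ∀ t ∈ L i, ¬ IsOHeavyPair G s t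

theorem LightLeg.adj (N : NetConfig G H K L a b) {i : Fin 3} (hi : LightLeg G L i) {x u v o : V}
    (hx : x ∈ L i) (ho : o ∉ L i) (hxo : H.Adj x o) (hu : u ∈ L i) (hv : v ∈ L i)
    (hxu : G.Adj x u) (hxv : G.Adj x v) (huv : u ≠ v) : G.Adj u v :=
  (N.pair.adj_or_isOHeavyPair (N.lineL i) hx ho hxo hu hv hxu hxv huv).resolve_right (hi u hu v hv)

theorem LightLeg.adj_a (N : NetConfig G H K L a b) {i : Fin 3} (hi : LightLeg G L i) {u v : V}
    (hu : u ∈ L i) (hv : v ∈ L i) (hxu : G.Adj (a i) u) (hxv : G.Adj (a i) v) (huv : u ≠ v) :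
    G.Adj u v := by
  obtain ⟨j, hji, -⟩ := exists_third i i
  exact hi.adj N (N.aL i) (fun h => N.inj j i hji (N.eq_of_mem h (N.aK j)))
    (N.lineK.1 _ (N.aK i) _ (N.aK j) (N.inj i j hji.symm)) hu hv hxu hxv huv

/-- By 2-connectivity some vertex of the leg other than `a i` has a neighbour outside. If no
`G`-neighbour of `a i` does, the leg contains a `G`-path `a i p q` with `q` not adjacent to `a i`;
lightness keeps these two apart, and the path extends to a wounded. -/
theorem exists_interior_nbr (N : NetConfig G H K L a b) {i : Fin 3} (hi : LightLeg G L i) :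
    ∃ c ∈ L i, G.Adj (a i) c ∧ ∃ x, H.Adj c x ∧ x ∉ L i := by
  by_contra! hcon
  obtain ⟨j, hji, -⟩ := exists_third i i
  obtain ⟨s, hs, hsa, t, ht, -, hst⟩ := N.pair.twoConn (a i) (L i) (b i) (N.bL i) (N.b_ne i) (a j)
    (fun h => N.inj j i hji (N.eq_of_mem h (N.aK j))) (N.inj j i hji)
  have has : ¬ G.Adj (a i) s := fun h => ht (hcon s hs h t hst)
  obtain ⟨p, hp, hpS, -, q, hq, hqS, -, hpq⟩ := N.pair.linked (L i) (N.lineL i) ∅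
    {w | w = a i ∨ G.Adj (a i) w} Set.subsingleton_empty (a i) (N.aL i) (Or.inl rfl)
    (Set.notMem_empty _) s hs (fun h => h.elim hsa has) (Set.notMem_empty _)
  have hqa : q ≠ a i := fun e => hqS (Or.inl e)
  have haq : ¬ G.Adj (a i) q := fun e => hqS (Or.inr e)
  have hap : G.Adj (a i) p := by
    rcases hpS with rfl | h
    · exact absurd hpq haq
    · exact h
  obtain ⟨m, hm, c, hc, hmc, hqc⟩ := N.exists_pendant i hq hqa
  obtain ⟨l, hli, hlm⟩ := exists_third i m
  exact N.wounded_leg hm.symm hli.symm hlm.symm hp hap hpq ⟨haq, hi _ (N.aL i) _ hq⟩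
    (N.pair.apart (N.not_adj_a hm.symm hq hqa)).symm
    (N.pair.apart (N.not_adj_a hli.symm hq hqa)).symm hc hmc
    (fun h => N.disjoint hm hc (hcon p hp hap c h)) hqc

/-- If `d` is on no other leg, woundeds along `a i c d` force `d` to see every `G`-neighbour of `a
m` in `L m`. But `d` sees at most one vertex of `L m`, and a third vertex there would give `a m` a
second such neighbour. -/
theorem arm_weak (N : NetConfig G H K L a b) {i : Fin 3} {c d : V} (hc : c ∈ L i)
    (hac : G.Adj (a i) c) (hcd : G.Adj c d) (hd : d ∉ L i) :
    (∃ m, m ≠ i ∧ d ∈ L m) ∨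
      ∀ m, m ≠ i → H.Adj d (b m) ∧ ∀ x ∈ L m, x = a m ∨ x = b m := by
  by_contra! hcon
  obtain ⟨hdm, m, hmi, hm⟩ := hcon
  have hcd' := N.pair.le hcd
  have had : ¬ H.Adj d (a i) := fun h => hd ((N.lineL i).2 c hc _ (N.aL i) hac.ne' d hcd'.symm h)
  have hdK : d ∉ K := by
    intro h
    by_cases e : d = a i
    · exact hd (e ▸ N.aL i)
    · exact had (N.lineK.1 d h _ (N.aK i) e)
  have hdl : ∀ l, l ≠ i → ¬ H.Adj (a l) d := fun l hl h =>
    (N.mem_of_adj_a h).elim hdK (hdm l hl)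
  have hblock : ∀ c' ∈ L m, G.Adj (a m) c' → H.Adj d c' := by
    intro c' hc' hmc'
    by_contra hdc'
    obtain ⟨l, hli, hlm⟩ := exists_third i m
    refine N.wounded_leg hmi.symm hli.symm hlm.symm hc hac hcd
      (N.pair.apart fun h => had h.symm) (N.pair.apart (hdl m hmi)) (N.pair.apart (hdl l hli))
      hc' hmc' (fun h => hdc' ?_) hdc'
    exact (N.lineL i).adj_of_notMem N.pair.claw hc (N.aL i) hac.ne hd (N.disjoint hmi hc') hcd' h
      fun e => hdm m hmi (e ▸ hc')
  obtain ⟨c', hc', hmc'⟩ := N.exists_leg_nbr m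
  have hall : ∀ x ∈ L m, x = a m ∨ x = c' := by
    intro x hx
    by_contra! hxn
    obtain ⟨w, hw, hwc, hmw⟩ := N.exists_leg_nbr_ne hx hxn.1 hxn.2 hmc'.ne
    exact hwc ((N.lineL m).unique hw hc' (hdm m hmi) (hblock w hw hmw) (hblock c' hc' hmc'))
  have hbc : b m = c' := (hall _ (N.bL m)).resolve_left (N.b_ne m)
  obtain ⟨x, hx, hxa, hxb⟩ := hm (hbc ▸ hblock c' hc' hmc')
  exact (hall x hx).elim hxa (hbc ▸ hxb)

/-- A `G`-path of length two that leaves a leg ends in another leg. -/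
theorem arm_mem (N : NetConfig G H K L a b) {i : Fin 3} {c d : V} (hc : c ∈ L i)
    (hac : G.Adj (a i) c) (hcd : G.Adj c d) (hd : d ∉ L i) : ∃ m, m ≠ i ∧ d ∈ L m := by
  refine (N.arm_weak hc hac hcd hd).resolve_right fun hB => ?_
  have hcd' := N.pair.le hcd
  -- Otherwise `b j` is on the line of `c d` and has a `G`-neighbour there other than `c`;
  -- `arm_weak`, applied from the leg `j`, leaves no place for that neighbour.
  have key : ∀ j k, j ≠ i → k ≠ i → j ≠ k → ¬ H.Adj c (b j) := by
    intro j k hji hki hjk hcb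
    obtain ⟨X, hX, hcX, hdX⟩ := N.pair.diamond.exists_isLine hcd'
    have hbX : b j ∈ X := hX.2 c hcX d hdX hcd.ne _ hcb.symm (hB j hji).1.symm
    have hcj := N.disjoint hji.symm hc
    obtain ⟨d', hd'X, hd'c, hbd'⟩ := N.pair.exists_nbr_ne hX hbX hdX (hB j hji).1.ne hcd.ne'
      hcb.ne'
    have hd'j : d' ∉ L j := fun h =>
      hbd'.ne (N.line_inter hX hbX (N.bL j) hd'X h hcX hcj)
    have hab : G.Adj (a j) (b j) := by
      obtain ⟨x, hx, hjx⟩ := N.exists_leg_nbr j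
      rcases (hB j hji).2 x hx with rfl | rfl
      · exact absurd rfl hjx.ne
      · exact hjx
    rcases N.arm_weak (N.bL j) hab hbd' hd'j with ⟨m, hmj, hd'm⟩ | h
    · by_cases hmi : m = i
      · subst hmi
        exact hd'c (N.line_inter hX hd'X hd'm hcX hc hdX hd)
      · have hmk : m = k := by omega
        subst hmk
        rcases (hB m hki).2 d' hd'm with rfl | rfl
        · exact N.not_adj_a hjk (N.bL j) (N.b_ne j) (N.pair.le hbd')
        · exact N.bb j m hjk (N.pair.le hbd')
    · rcases (h i hji.symm).2 c hc with rfl | rfl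
      · exact hac.ne rfl
      · exact N.bb i j hji.symm hcb
  obtain ⟨j, k, hjk, hji, hki⟩ := exists_others i
  rcases N.pair.claw d c (b j) (b k) hcd'.symm (hB j hji).1 (hB k hki).1
    (fun e => N.disjoint hji (N.bL j) (e ▸ hc)) (fun e => N.disjoint hjk (N.bL j) (e ▸ N.bL k))
    (fun e => N.disjoint hki (N.bL k) (e ▸ hc)) with h | h | h
  · exact key j k hji hki hjk h
  · exact N.bb j k hjk h
  · exact key k j hki hji hjk.symm h

theorem arm_mem_or (N : NetConfig G H K L a b) {i j k : Fin 3} (hij : i ≠ j) (hik : i ≠ k)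
    (hjk : j ≠ k) {c d : V} (hc : c ∈ L i) (hac : G.Adj (a i) c) (hcd : G.Adj c d) (hd : d ∉ L i) :
    d ∈ L j ∨ d ∈ L k := by
  obtain ⟨m, hm, hdm⟩ := N.arm_mem hc hac hcd hd
  by_cases h : m = j
  · exact Or.inl (h ▸ hdm)
  · have : m = k := by omega
    exact Or.inr (this ▸ hdm)

/-- If the `G`-neighbours of `a j` in the leg are two interior vertices, there are no further
vertices in the leg. -/
theorem leg_eq (N : NetConfig G H K L a b) {j : Fin 3} {c w o o' : V} (hc : c ∈ L j) (hw : w ∈ L j)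
    (hjc : G.Adj (a j) c) (hjw : G.Adj (a j) w) (ho : o ∉ L j) (hco : H.Adj c o) (ho' : o' ∉ L j)
    (hwo' : H.Adj w o') (hall : ∀ x ∈ L j, G.Adj (a j) x → x = c ∨ x = w) :
    ∀ x ∈ L j, x = a j ∨ x = c ∨ x = w := by
  by_contra! hcon
  obtain ⟨x, hx, hxa, hxc, hxw⟩ := hcon
  obtain ⟨s, hs, hsS, -, t, ht, htS, -, hst⟩ := N.pair.linked (L j) (N.lineL j) ∅ {a j, c, w}
    Set.subsingleton_empty (a j) (N.aL j) (Or.inl rfl) (Set.notMem_empty _) x hx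
    (by rintro (h | h | h); exacts [hxa h, hxc h, hxw h]) (Set.notMem_empty _)
  have hta : t ≠ a j := fun e => htS (Or.inl e)
  have htn : ¬ G.Adj (a j) t := fun h => by
    rcases hall t ht h with rfl | rfl
    · exact htS (Or.inr (Or.inl rfl))
    · exact htS (Or.inr (Or.inr rfl))
  -- Otherwise `a j` and `t` are `o`-heavy, and `exists_leaf` would make `c` or `w` a vertex without
  -- neighbours outside the leg.
  have key : ∀ s ∈ L j, G.Adj (a j) s → (∃ o, H.Adj s o ∧ o ∉ L j) → ¬ G.Adj s t := by
    rintro s hs hjs ⟨o, hso, ho⟩ hst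
    rcases N.pair.adj_or_isOHeavyPair (N.lineL j) hs ho hso (N.aL j) ht hjs.symm hst hta.symm with
      h | h
    · exact htn h
    · obtain ⟨l, hl, hal, -, hleaf⟩ := N.pair.exists_leaf (N.lineL j) (N.aL j) ht h
      rcases hall l hl hal with rfl | rfl
      · exact absurd (hleaf _ hco) (by assumption)
      · exact absurd (hleaf _ hwo') (by assumption)
  rcases hsS with rfl | rfl | rfl
  · exact htn hst
  · exact key s hs hjc ⟨o, hco, ho⟩ hst
  · exact key s hs hjw ⟨o', hwo', ho'⟩ hst

/-- Let `X` be the line of `c₂ c₃` and `w` a second `G`-neighbour of `a j` in its leg. Woundeds on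
the triangle `w c₂ (a j)` push each `G`-neighbour of `a i` in its leg onto `X` or next to `w` and,
once one is on `X`, those of `a k` other than `c₃` next to `w`. By `leg_eq` and `Linked` the
vertices `b i`, `b j`, `b k` are then pinned down until two of them are adjacent. -/
theorem no_square_aux (N : NetConfig G H K L a b) {i j k : Fin 3} (hij : i ≠ j) (hik : i ≠ k)
    (hjk : j ≠ k) (hj : LightLeg G L j) {c₂ c₃ : V} (h2 : c₂ ∈ L j)
    (h3 : c₃ ∈ L k) (hc2 : G.Adj (a j) c₂) (hc3 : G.Adj (a k) c₃) (h23 : G.Adj c₂ c₃)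
    (hb : b j ≠ c₂) : False := by
  obtain ⟨X, hX, h2X, h3X⟩ := N.pair.diamond.exists_isLine (N.pair.le h23)
  have h2k := N.disjoint hjk h2
  have h3j := N.disjoint hjk.symm h3
  have h2i := N.disjoint hij.symm h2
  have hXj : ∀ x ∈ X, x ∈ L j → x = c₂ := fun x hx hxj => N.line_inter hX hx hxj h2X h2 h3X h3j
  have hXk : ∀ x ∈ X, x ∈ L k → x = c₃ := fun x hx hxk => N.line_inter hX hx hxk h3X h3 h2X h2k
  have hXi : ∀ x ∈ X, x ∈ L i → ∀ y ∈ X, y ∈ L i → x = y := fun x hx hxi y hy hyi =>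
    N.line_inter hX hx hxi hy hyi h2X h2i
  have n2 : ∀ v, H.Adj c₂ v → v ∈ L j ∨ v ∈ X := fun v hv =>
    N.mem_of_adj_leg hX h2 hc2.ne' h2X h3X h3j hv
  have n3 : ∀ v, H.Adj c₃ v → v ∈ L k ∨ v ∈ X := fun v hv =>
    N.mem_of_adj_leg hX h3 hc3.ne' h3X h2X h2k hv
  have claim1 : ∀ w ∈ L j, G.Adj (a j) w → w ≠ c₂ → ∀ c ∈ L i, G.Adj (a i) c → c ∉ X →
      H.Adj c w := by
    intro w hw hjw hwc c hc hic hcX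
    by_contra hcw
    have hwc2 := hj.adj_a N hw h2 hjw hc2 hwc
    refine N.pair.wounded.no_wounded hwc2 hjw.symm hc2.symm h23 (N.adj_triangle hij.symm) hic
      (N.pair.apart fun h => hwc ((N.lineL j).unique hw h2 h3j h.symm (N.pair.le h23.symm)))
      (N.pair.apart (N.not_adj_a hij.symm hw hjw.ne')) (N.pair.apart fun h => hcw h.symm)
      (N.pair.apart (N.not_adj_a hij.symm h2 hc2.ne'))
      (N.pair.apart fun h => (n2 c h).elim (N.disjoint hij hc) hcX)
      (N.pair.apart (N.not_adj_a hjk.symm h3 hc3.ne')).symm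
      (N.pair.apart (N.not_adj_a hij hc hic.ne')).symm
      (N.pair.apart (N.not_adj_a hik.symm h3 hc3.ne'))
      (N.pair.apart fun h => (n3 c h).elim (N.disjoint hik hc) hcX)
  have claim2 : ∀ c₁ ∈ L i, c₁ ∈ X → G.Adj c₂ c₁ := by
    intro c₁ h1 h1X
    obtain ⟨d, hdX, hd3, h2d⟩ := N.pair.exists_nbr_ne hX h2X h1X (fun e => h2i (e ▸ h1))
      (fun e => N.disjoint hik h1 (e ▸ h3)) h23.ne
    have hdj : d ∉ L j := fun h => h2d.ne (hXj d hdX h).symm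
    rcases N.arm_mem_or hij.symm hjk hik h2 hc2 h2d hdj with h | h
    · rwa [← hXi d hdX h c₁ h1X h1]
    · exact absurd (hXk d hdX h) hd3
  have claim3 : ∀ c₁ ∈ L i, G.Adj (a i) c₁ → c₁ ∈ X → ∀ w ∈ L j, G.Adj (a j) w → w ≠ c₂ →
      ∀ x ∈ L k, G.Adj (a k) x → x ≠ c₃ → H.Adj x w := by
    intro c₁ h1 hc1 h1X w hw hjw hwc x hx hkx hxc
    by_contra hxw
    have hwc2 := hj.adj_a N hw h2 hjw hc2 hwc
    have h1j := N.disjoint hij h1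
    refine N.pair.wounded.no_wounded hwc2 hjw.symm hc2.symm (claim2 c₁ h1 h1X)
      (N.adj_triangle hjk) hkx
      (N.pair.apart fun h => hwc ((N.lineL j).unique hw h2 h1j h.symm
        (N.pair.le (claim2 c₁ h1 h1X).symm)))
      (N.pair.apart (N.not_adj_a hjk hw hjw.ne')) (N.pair.apart fun h => hxw h.symm)
      (N.pair.apart (N.not_adj_a hjk h2 hc2.ne'))
      (N.pair.apart fun h => (n2 x h).elim (N.disjoint hjk.symm hx) fun hxX => hxc (hXk x hxX hx))
      (N.pair.apart (N.not_adj_a hij h1 hc1.ne')).symm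
      (N.pair.apart (N.not_adj_a hjk.symm hx hkx.ne')).symm
      (N.pair.apart (N.not_adj_a hik h1 hc1.ne'))
      (N.pair.apart fun h => ?_)
    rcases N.mem_of_adj_leg hX h1 hc1.ne' h1X h2X h2i h with hh | hh
    · exact N.disjoint hik hh hx
    · exact hxc (hXk x hh hx)
  obtain ⟨w, hw, hwc, hjw⟩ := N.exists_leg_nbr_ne (N.bL j) (N.b_ne j) hb hc2.ne
  -- the leg `k` cannot exist once `a i` has a neighbour in `X` which is `b i`
  have fin : ∀ c₁ ∈ L i, G.Adj (a i) c₁ → c₁ ∈ X → b i = c₁ → b j = w → False := by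
    intro c₁ h1 hc1 h1X hbi hbj
    have h13 : H.Adj c₁ c₃ := hX.1 c₁ h1X c₃ h3X fun e => N.disjoint hik h1 (e ▸ h3)
    have hbk : b k ≠ c₃ := fun e => N.bb i k hik (by rw [hbi, e]; exact h13)
    obtain ⟨x, hx, hxc, hkx⟩ := N.exists_leg_nbr_ne (N.bL k) (N.b_ne k) hbk hc3.ne
    have hxw := claim3 c₁ h1 hc1 h1X w hw hjw hwc x hx hkx hxc
    have hwk := N.disjoint hjk hw
    have hall := N.leg_eq h3 hx hc3 hkx h2k (N.pair.le h23.symm) hwk hxw fun y hy hky => by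
      by_contra! hcon
      exact hcon.2 ((N.lineL k).unique hy hx hwk
        (claim3 c₁ h1 hc1 h1X w hw hjw hwc y hy hky hcon.1).symm hxw.symm)
    rcases hall _ (N.bL k) with h | h | h
    · exact N.b_ne k h
    · exact hbk h
    · exact N.bb j k hjk (by rw [hbj, h]; exact hxw.symm)
  by_cases hv : ∃ v ∈ L i, G.Adj (a i) v ∧ v ∉ X
  · obtain ⟨v, hv, hiv, hvX⟩ := hv
    have hvw := claim1 w hw hjw hwc v hv hiv hvX
    have hvj := N.disjoint hij hv
    have hwi := N.disjoint hij.symm hw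
    have hbj : b j = w := by
      have hall := N.leg_eq h2 hw hc2 hjw h3j (N.pair.le h23) hvj hvw.symm fun y hy hjy => by
        by_contra! hcon
        exact hcon.2 ((N.lineL j).unique hy hw hvj (claim1 y hy hjy hcon.1 v hv hiv hvX) hvw)
      rcases hall _ (N.bL j) with h | h | h
      · exact absurd h (N.b_ne j)
      · exact absurd h hb
      · exact h
    have hbi : b i ≠ v := fun e => N.bb i j hij (by rw [e, hbj]; exact hvw)
    obtain ⟨c₁, h1, h1v, hc1⟩ := N.exists_leg_nbr_ne (N.bL i) (N.b_ne i) hbi hiv.ne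
    have hX1 : ∀ y ∈ L i, G.Adj (a i) y → y ≠ v → y ∈ X := by
      intro y hy hiy hyv
      by_contra hyX
      exact hyv ((N.lineL i).unique hy hv hwi (claim1 w hw hjw hwc y hy hiy hyX).symm hvw.symm)
    have h1X := hX1 c₁ h1 hc1 h1v
    have hall := N.leg_eq h1 hv hc1 hiv h2i (N.pair.le (claim2 c₁ h1 h1X).symm) hwi hvw
      fun y hy hiy => by
        by_cases hyv : y = v
        · exact Or.inr hyv
        · exact Or.inl (hXi y (hX1 y hy hiy hyv) hy c₁ h1X h1)
    rcases hall _ (N.bL i) with h | h | h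
    · exact N.b_ne i h
    · exact fin c₁ h1 hc1 h1X h hbj
    · exact hbi h
  · push Not at hv
    obtain ⟨c₁, h1, hc1⟩ := N.exists_leg_nbr i
    have h1X := hv c₁ h1 hc1
    have hbi : b i = c₁ := by
      by_contra hbi
      obtain ⟨y, hy, hyc, hiy⟩ := N.exists_leg_nbr_ne (N.bL i) (N.b_ne i) hbi hc1.ne
      exact hyc (hXi y (hv y hy hiy) hy c₁ h1X h1)
    have h13 : H.Adj c₁ c₃ := hX.1 c₁ h1X c₃ h3X fun e => N.disjoint hik h1 (e ▸ h3)
    have hbk : b k ≠ c₃ := fun e => N.bb i k hik (by rw [hbi, e]; exact h13)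
    obtain ⟨x, hx, hxc, hkx⟩ := N.exists_leg_nbr_ne (N.bL k) (N.b_ne k) hbk hc3.ne
    have hxw := claim3 c₁ h1 hc1 h1X w hw hjw hwc x hx hkx hxc
    have hxj := N.disjoint hjk.symm hx
    have hall := N.leg_eq h2 hw hc2 hjw h3j (N.pair.le h23) hxj hxw.symm fun y hy hjy => by
      by_contra! hcon
      exact hcon.2 ((N.lineL j).unique hy hw hxj
        (claim3 c₁ h1 hc1 h1X y hy hjy hcon.1 x hx hkx hxc) hxw)
    rcases hall _ (N.bL j) with h | h | h
    · exact N.b_ne j h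
    · exact hb h
    · exact fin c₁ h1 hc1 h1X hbi h

/-- Two light legs are not joined by an edge of `G` between neighbours of their roots. -/
theorem no_square (N : NetConfig G H K L a b) {i j k : Fin 3} (hij : i ≠ j) (hik : i ≠ k)
    (hjk : j ≠ k) (hj : LightLeg G L j) (hk : LightLeg G L k) {c₂ c₃ : V} (h2 : c₂ ∈ L j)
    (h3 : c₃ ∈ L k) (hc2 : G.Adj (a j) c₂) (hc3 : G.Adj (a k) c₃) : ¬ G.Adj c₂ c₃ := by
  intro h23
  by_cases hb : b j = c₂
  · by_cases hb' : b k = c₃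
    · exact N.bb j k hjk (by rw [hb, hb']; exact N.pair.le h23)
    · exact N.no_square_aux hik hij hjk.symm hk h3 h2 hc3 hc2 h23.symm hb'
  · exact N.no_square_aux hij hik hjk hj h2 h3 hc2 hc3 h23 hb

/-- For a second `G`-neighbour `w` of `a j`, a wounded forces `w` next to a `G`-neighbour `c` of `a
k`. By `no_square` all `G`-neighbours of `w` on the line of `c w` are in `L i`, which meets that
line at most once, whereas `Linked` provides two of them. -/
theorem no_mixed_square (N : NetConfig G H K L a b) {i j k : Fin 3} (hij : i ≠ j) (hik : i ≠ k)
    (hjk : j ≠ k) (hj : LightLeg G L j) (hk : LightLeg G L k) {c₁ c₂ : V} (h1 : c₁ ∈ L i)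
    (h2 : c₂ ∈ L j) (hc1 : G.Adj (a i) c₁) (hc2 : G.Adj (a j) c₂) (hb : b j ≠ c₂) :
    ¬ G.Adj c₁ c₂ := by
  intro h12
  obtain ⟨X, hX, h1X, h2X⟩ := N.pair.diamond.exists_isLine (N.pair.le h12)
  have h2i := N.disjoint hij.symm h2
  have h1j := N.disjoint hij h1
  have hsq := fun {x y : V} => @no_square V _ G H K L a b N i j k hij hik hjk hj hk x y
  obtain ⟨w, hw, hwc, hjw⟩ := N.exists_leg_nbr_ne (N.bL j) (N.b_ne j) hb hc2.ne
  have hwc2 := hj.adj_a N hw h2 hjw hc2 hwc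
  have hwk := N.disjoint hjk hw
  have hwi := N.disjoint hij.symm hw
  obtain ⟨c, hc, hkc⟩ := N.exists_leg_nbr k
  have hcj := N.disjoint hjk.symm hc
  have hci := N.disjoint hik.symm hc
  have hcX : c ∉ X := by
    intro hcX
    obtain ⟨d, hdX, hd1, h2d⟩ := N.pair.exists_nbr_ne hX h2X hcX (fun e => hcj (e ▸ h2))
      (fun e => hci (e ▸ h1)) h12.ne'
    have hdj : d ∉ L j := fun h => h2d.ne (N.line_inter hX h2X h2 hdX h h1X h1j)
    rcases N.arm_mem_or hij.symm hjk hik h2 hc2 h2d hdj with h | h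
    · exact hd1 (N.line_inter hX hdX h h1X h1 h2X h2i)
    · have : d = c := N.line_inter hX hdX h hcX hc h1X (N.disjoint hik h1)
      subst this
      exact hsq h2 h hc2 hkc h2d
  have hcw : H.Adj c w := by
    by_contra hcw
    exact N.pair.wounded.no_wounded hwc2 hjw.symm hc2.symm h12.symm (N.adj_triangle hjk) hkc
      (N.pair.apart fun h => hwc ((N.lineL j).unique hw h2 h1j h.symm (N.pair.le h12)))
      (N.pair.apart (N.not_adj_a hjk hw hjw.ne')) (N.pair.apart fun h => hcw h.symm)
      (N.pair.apart (N.not_adj_a hjk h2 hc2.ne'))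
      (N.pair.apart fun h =>
        (N.mem_of_adj_leg hX h2 hc2.ne' h2X h1X h1j h).elim hcj hcX)
      (N.pair.apart (N.not_adj_a hij h1 hc1.ne')).symm
      (N.pair.apart (N.not_adj_a hjk.symm hc hkc.ne')).symm
      (N.pair.apart (N.not_adj_a hik h1 hc1.ne'))
      (N.pair.apart fun h =>
        (N.mem_of_adj_leg hX h1 hc1.ne' h1X h2X h2i h).elim hci hcX)
  obtain ⟨Y, hY, hcY, hwY⟩ := N.pair.diamond.exists_isLine hcw
  -- the `G`-neighbours of `w` in `Y` are in the leg `i`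
  have hYi : ∀ d ∈ Y, G.Adj w d → d ∈ L i := by
    intro d hdY hwd
    have hdj : d ∉ L j := fun h => hwd.ne (N.line_inter hY hwY hw hdY h hcY hcj)
    refine (N.arm_mem_or hij.symm hjk hik hw hjw hwd hdj).resolve_right fun h => ?_
    have : d = c := N.line_inter hY hdY h hcY hc hwY hwk
    subst this
    exact hsq hw h hjw hkc hwd
  obtain ⟨v, hvY, hwv⟩ := N.pair.exists_nbr hY hwY hcY hcw.ne
  have hvi := hYi v hvY hwv
  obtain ⟨d, hdY, hdv, hwd⟩ := N.pair.exists_nbr_ne hY hwY hcY hcw.ne (fun e => hci (e ▸ hvi)) hwv.ne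
  exact hdv (N.line_inter hY hdY (hYi d hdY hwd) hvY hvi hwY hwi)

/-- If `d` were on `L k`, `no_square` makes it nonadjacent to `a k`, and woundeds along `a j c d`
put all `G`-neighbours of `a i` in its leg on the line of `c d`. So there is only one, it equals `b
i`, and its edge to `c` contradicts `no_mixed_square`. -/
theorem arm_mem_heavy_leg (N : NetConfig G H K L a b) {i j k : Fin 3} (hij : i ≠ j) (hik : i ≠ k)
    (hjk : j ≠ k) (hj : LightLeg G L j) (hk : LightLeg G L k) {c d : V} (hc : c ∈ L j)
    (hjc : G.Adj (a j) c) (hcd : G.Adj c d) (hd : d ∉ L j) : d ∈ L i := by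
  refine (N.arm_mem_or hij.symm hjk hik hc hjc hcd hd).resolve_right fun hdk => ?_
  have hda : d ≠ a k := fun e => N.not_adj_a hjk hc hjc.ne' (e ▸ N.pair.le hcd)
  by_cases hkd : G.Adj (a k) d
  · exact N.no_square hij hik hjk hj hk hc hdk hjc hkd hcd
  obtain ⟨X, hX, hcX, hdX⟩ := N.pair.diamond.exists_isLine (N.pair.le hcd)
  have hck := N.disjoint hjk hc
  have hci := N.disjoint hij.symm hc
  have hmem : ∀ x ∈ L i, G.Adj (a i) x → x ∈ X := by
    intro x hx hix
    by_contra hxX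
    refine N.wounded_leg hij.symm hjk hik hc hjc hcd
      (N.pair.apart (N.not_adj_a hjk.symm hdk hda)).symm
      (N.pair.apart (N.not_adj_a hik.symm hdk hda)).symm
      ⟨hkd, hk _ (N.aL k) _ hdk⟩ hx hix (fun h => ?_) (fun h => ?_)
    · exact (N.mem_of_adj_leg hX hc hjc.ne' hcX hdX hd h).elim (N.disjoint hij hx) hxX
    · exact (N.mem_of_adj_leg hX hdk hda hdX hcX hck h).elim (N.disjoint hik hx) hxX
  obtain ⟨x, hx, hix⟩ := N.exists_leg_nbr i
  have hxX := hmem x hx hix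
  have hXi : ∀ y ∈ X, y ∈ L i → y = x := fun y hy hyi => N.line_inter hX hy hyi hxX hx hcX hci
  obtain ⟨e, heX, hed, hxe⟩ := N.pair.exists_nbr_ne hX hxX hcX (fun e => hci (e ▸ hx)) hcd.ne
    (fun e => N.disjoint hik hx (e ▸ hdk))
  have hxc : G.Adj x c := by
    rcases N.arm_mem_or hij hik hjk hx hix hxe (fun h => hxe.ne (hXi e heX h).symm) with h | h
    · rwa [N.line_inter hX heX h hcX hc hdX hd] at hxe
    · exact absurd (N.line_inter hX heX h hdX hdk hcX hck) hed
  have hbi : b i = x := by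
    by_contra hbi
    obtain ⟨y, hy, hyx, hiy⟩ := N.exists_leg_nbr_ne (N.bL i) (N.b_ne i) hbi hix.ne
    exact hyx (hXi y (hmem y hy hiy) hy)
  exact N.no_mixed_square hij hik hjk hj hk hx hc hix hjc
    (fun e => N.bb i j hij (by rw [hbi, e]; exact N.pair.le hxc)) hxc

/-- All `G`-neighbours of `c` on its second line `X` are in `L i`, which meets `X` at most once. A
third vertex of `X` would provide a second such neighbour, so `X = {c, e}`. -/
theorem leg_end (N : NetConfig G H K L a b) {i j k : Fin 3} (hij : i ≠ j) (hik : i ≠ k)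
    (hjk : j ≠ k) (hj : LightLeg G L j) (hk : LightLeg G L k) :
    ∃ c ∈ L j, G.Adj (a j) c ∧ ∃ e ∈ L i, e ≠ a i ∧ G.Adj c e ∧
      (∀ v, H.Adj c v → v ∈ L j ∨ v = e) ∧ ∀ v, H.Adj e v → v ∈ L i ∨ v = c := by
  obtain ⟨c, hc, hjc, x, hcx, hx⟩ := N.exists_interior_nbr hj
  obtain ⟨X, hX, hcX, hxX⟩ := N.pair.diamond.exists_isLine hcx
  have hXj : ∀ y ∈ X, y ∈ L j → y = c := fun y hy hyj => N.line_inter hX hy hyj hcX hc hxX hx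
  have hci := N.disjoint hij.symm hc
  have harm : ∀ y ∈ X, G.Adj c y → y ∈ L i := fun y hy hcy =>
    N.arm_mem_heavy_leg hij hik hjk hj hk hc hjc hcy fun h => hcy.ne (hXj y hy h).symm
  obtain ⟨e, heX, hce⟩ := N.pair.exists_nbr hX hcX hxX hcx.ne'
  have hei := harm e heX hce
  have hea : e ≠ a i := fun h => N.not_adj_a hij.symm hc hjc.ne' (h ▸ N.pair.le hce)
  have hXe : ∀ y ∈ X, y = c ∨ y = e := by
    intro y hy
    by_contra! hcon
    obtain ⟨d, hdX, hde, hcd⟩ := N.pair.exists_nbr_ne hX hcX hy hcon.1 hcon.2 hce.ne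
    exact hde (N.line_inter hX hdX (harm d hdX hcd) heX hei hcX hci)
  refine ⟨c, hc, hjc, e, hei, hea, hce, fun v hv => ?_, fun v hv => ?_⟩
  · refine (N.mem_of_adj_leg hX hc hjc.ne' hcX hxX hx hv).imp_right fun h =>
      (hXe v h).resolve_left hv.ne'
  · refine (N.mem_of_adj_leg hX hei hea heX hcX hci hv).imp_right fun h =>
      (hXe v h).resolve_right hv.ne'

end NetConfig

/-! ### Short legs and the size of the third leg -/

theorem deg_add_ncard_le [Fintype V] {G : SimpleGraph V} {v : V} {Q S E : Set V} (hS : S ⊆ Q)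
    (hv : ∀ x, G.Adj v x → (x ∈ Q ∧ x ∉ S) ∨ x ∈ E) :
    deg G v + S.ncard ≤ Q.ncard + E.ncard := by
  have h1 : deg G v ≤ ((Q \ S) ∪ E).ncard := by
    rw [deg_eq_ncard]
    exact Set.ncard_le_ncard (fun x hx => hv x hx) (Set.toFinite _)
  have h2 := Set.ncard_union_le (Q \ S) E
  have h3 := Set.ncard_sdiff_add_ncard_of_subset hS (Set.toFinite _)
  omega

theorem ncard_triple {x y z : V} (hxy : x ≠ y) (hxz : x ≠ z) (hyz : y ≠ z) :
    ({x, y, z} : Set V).ncard = 3 :=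
  Set.ncard_eq_three.2 ⟨x, y, z, hxy, hxz, hyz, rfl⟩

theorem net_adj_inl {i j : Fin 3} (hij : i ≠ j) : net.Adj (Sum.inl i) (Sum.inl j) := by
  simp [net, hij]

theorem net_adj_inl_inr {i j : Fin 3} : net.Adj (Sum.inl i) (Sum.inr j) ↔ i = j := by
  simp [net]

theorem not_net_adj_inr {i j : Fin 3} : ¬ net.Adj (Sum.inr i) (Sum.inr j) := by
  simp [net]

namespace NetConfig

variable [Fintype V] {G H : SimpleGraph V} {K : Set V} {L : Fin 3 → Set V} {a b : Fin 3 → V}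

/-- The leg `L j` is an edge `a j b j`, and `b j` has one further neighbour, the vertex `e` of the
leg `L i`. -/
structure ShortLeg (G H : SimpleGraph V) (L : Fin 3 → Set V) (a b : Fin 3 → V) (i j : Fin 3)
    (e : V) : Prop where
  mem : e ∈ L i
  ne : e ≠ a i
  ab : G.Adj (a j) (b j)
  be : G.Adj (b j) e
  eq : ∀ x ∈ L j, x = a j ∨ x = b j
  nb : ∀ v, H.Adj (b j) v → v = a j ∨ v = e
  nbe : ∀ v, H.Adj e v → v ∈ L i ∨ v = b j

/-- A third vertex in the leg gives `a j` a second `G`-neighbour `w`, and then a wounded with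
triangle `w c (a j)`, pendant edge `c e` and long path `a j`, `a k`, `c'` into the other light leg.
-/
theorem exists_shortLeg (N : NetConfig G H K L a b) {i j k : Fin 3} (hij : i ≠ j) (hik : i ≠ k)
    (hjk : j ≠ k) (hj : LightLeg G L j) (hk : LightLeg G L k) :
    ∃ e, ShortLeg G H L a b i j e := by
  obtain ⟨c, hc, hjc, e, he, hea, hce, hnc, hne⟩ := N.leg_end hij hik hjk hj hk
  obtain ⟨c', hc', hkc', e', he', hea', -, hnc', -⟩ := N.leg_end hik hij hjk.symm hk hj
  have hck := N.disjoint hjk hc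
  have hall : ∀ x ∈ L j, x = a j ∨ x = c := by
    intro x hx
    by_contra! hxn
    obtain ⟨w, hw, hwc, hjw⟩ := N.exists_leg_nbr_ne hx hxn.1 hxn.2 hjc.ne
    have hec' : ¬ H.Adj e c' := fun h =>
      (hne c' h).elim (N.disjoint hik.symm hc') fun h => hck (h ▸ hc')
    refine N.pair.wounded.no_wounded (hj.adj_a N hw hc hjw hjc hwc) hjw.symm hjc.symm hce
      (N.adj_triangle hjk) hkc'
      (N.pair.apart fun h => (hne w h.symm).elim (N.disjoint hij.symm hw) hwc)
      (N.pair.apart (N.not_adj_a hjk hw hjw.ne'))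
      (N.pair.apart fun h => (hnc' w h.symm).elim (N.disjoint hjk hw)
        fun h => N.disjoint hij.symm hw (h ▸ he'))
      (N.pair.apart (N.not_adj_a hjk hc hjc.ne'))
      (N.pair.apart fun h => (hnc' c h.symm).elim hck
        fun h => N.disjoint hij.symm hc (h ▸ he'))
      (N.pair.apart (N.not_adj_a hij he hea)).symm
      (N.pair.apart (N.not_adj_a hjk.symm hc' hkc'.ne')).symm
      (N.pair.apart (N.not_adj_a hik he hea)) (N.pair.apart hec')
  obtain rfl : b j = c := (hall _ (N.bL j)).resolve_left (N.b_ne j)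
  refine ⟨e, he, hea, hjc, hce, hall, fun v hv => ?_, hne⟩
  rcases hnc v hv with h | h
  · exact Or.inl ((hall v h).resolve_right hv.ne')
  · exact Or.inr h

section Short

variable {i j k : Fin 3} {e f : V}

theorem ShortLeg.not_adj (N : NetConfig G H K L a b) (hik : i ≠ k) (hjk : j ≠ k)
    (hj : ShortLeg G H L a b i j e) : ¬ H.Adj e (b k) := fun h =>
  (hj.nbe _ h).elim (N.disjoint hik.symm (N.bL k)) fun h => N.disjoint hjk.symm (N.bL k) (h ▸ N.bL j)

theorem ShortLeg.end_ne (N : NetConfig G H K L a b) (hik : i ≠ k) (hjk : j ≠ k)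
    (hj : ShortLeg G H L a b i j e) (hk : ShortLeg G H L a b i k f) : e ≠ f := fun h =>
  hj.not_adj N hik hjk (h ▸ N.pair.le hk.be.symm)

theorem ShortLeg.common_a (N : NetConfig G H K L a b) (hij : i ≠ j) (hik : i ≠ k) (hjk : j ≠ k)
    (hj : ShortLeg G H L a b i j e) (hk : ShortLeg G H L a b i k f) {t : V} (ht : t ∈ K)
    (hjt : G.Adj (a j) t) (hkt : G.Adj (a k) t) : t = a i := by
  by_contra hti
  exact N.pair.wounded.no_wounded hkt.symm hjt.symm (N.adj_triangle hjk.symm) hk.ab hj.ab hj.be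
    (N.pair.apart (N.not_adj_K (N.bL k) (N.b_ne k) ht hkt.ne')).symm
    (N.pair.apart (N.not_adj_K (N.bL j) (N.b_ne j) ht hjt.ne')).symm
    (N.pair.apart (N.not_adj_K hj.mem hj.ne ht hti)).symm
    (N.pair.apart (N.not_adj_a hjk (N.bL j) (N.b_ne j))).symm
    (N.pair.apart (N.not_adj_a hik hj.mem hj.ne)).symm
    (N.pair.apart (N.not_adj_a hjk.symm (N.bL k) (N.b_ne k))).symm
    (N.pair.apart (N.not_adj_a hij hj.mem hj.ne)).symm
    (N.pair.apart (N.bb k j hjk.symm)) (N.pair.apart (hj.not_adj N hik hjk)).symm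

/-- Any other `t` is `o`-heavy with `a k`. A common neighbour `s` of that pair without neighbours
outside `K` is in turn `o`-heavy with `a j`, and `le_of_leaf` makes the net `p`-heavy. -/
theorem ShortLeg.nbr_a (N : NetConfig G H K L a b) (hij : i ≠ j) (hik : i ≠ k) (hjk : j ≠ k)
    (hj : ShortLeg G H L a b i j e) (hk : ShortLeg G H L a b i k f) {t : V} (ht : t ∈ K)
    (hjt : G.Adj (a j) t) : t = a i ∨ t = a k := by
  by_contra! hcon
  have hb : ∀ m, H.Adj (a m) (b m) := fun m => (N.adj_a (N.bL m) (N.b_ne m)).symm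
  have hkt : ¬ G.Adj (a k) t := fun h => hcon.1 (hj.common_a N hij hik hjk hk ht hjt h)
  have h1 := (N.pair.adj_or_isOHeavyPair N.lineK (N.aK j) (N.bK j) (hb j) (N.aK k) ht
    (N.adj_triangle hjk) hjt hcon.2.symm).resolve_left hkt
  obtain ⟨s, hs, hks, -, hleaf⟩ := N.pair.exists_leaf N.lineK (N.aK k) ht h1
  have hsa : ∀ m, a m ≠ s := fun m h => N.bK m (hleaf _ (h ▸ hb m))
  have hjs : ¬ G.Adj (a j) s := fun h =>
    hsa i (hj.common_a N hij hik hjk hk hs h hks).symm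
  have h2 := (N.pair.adj_or_isOHeavyPair N.lineK (N.aK k) (N.bK k) (hb k) (N.aK j) hs
    (N.adj_triangle hjk.symm) hks (hsa j)).resolve_left hjs
  exact absurd (N.pair.le_of_leaf N.lineK hs (N.aK k) hleaf h2) (not_le.2 (N.np j k hjk))

/-- Once `a i` is deleted, no edge of `G` inside `K` leaves `{a j, a k}`, so connectedness leaves no
further vertex. -/
theorem ShortLeg.eq_K (N : NetConfig G H K L a b) (hij : i ≠ j) (hik : i ≠ k) (hjk : j ≠ k)
    (hj : ShortLeg G H L a b i j e) (hk : ShortLeg G H L a b i k f) {t : V} (ht : t ∈ K) :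
    t = a i ∨ t = a j ∨ t = a k := by
  by_contra! hcon
  obtain ⟨s, hs, hsS, -, x, hx, hxS, hxi, hsx⟩ := N.pair.linked K N.lineK {a i} {a j, a k}
    Set.subsingleton_singleton (a j) (N.aK j) (Or.inl rfl) (N.inj j i hij.symm) t ht
    (by rintro (h | h); exacts [hcon.2.1 h, hcon.2.2 h]) hcon.1
  rcases hsS with rfl | rfl
  · exact (hj.nbr_a N hij hik hjk hk hx hsx).elim hxi fun h => hxS (Or.inr h)
  · exact (hk.nbr_a N hik hij hjk.symm hj hx hsx).elim hxi fun h => hxS (Or.inl h)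

theorem ShortLeg.deg_a (N : NetConfig G H K L a b) (hij : i ≠ j) (hik : i ≠ k) (hjk : j ≠ k)
    (hj : ShortLeg G H L a b i j e) (hk : ShortLeg G H L a b i k f) : deg H (a j) = 3 := by
  have : H.neighborSet (a j) = {a i, a k, b j} := by
    ext v
    constructor
    · intro hv
      rcases N.mem_of_adj_a hv with h | h
      · rcases hj.eq_K N hij hik hjk hk h with h | h | h
        · exact Or.inl h
        · exact absurd h (H.ne_of_adj hv).symm
        · exact Or.inr (Or.inl h)
      · exact Or.inr (Or.inr ((hj.eq v h).resolve_left (H.ne_of_adj hv).symm))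
    · rintro (rfl | rfl | rfl)
      · exact N.pair.le (N.adj_triangle hij.symm)
      · exact N.pair.le (N.adj_triangle hjk)
      · exact N.pair.le hj.ab
  have hi : a i ≠ b j := fun h => N.bK j (h ▸ N.aK i)
  have hk' : a k ≠ b j := fun h => N.bK j (h ▸ N.aK k)
  rw [deg_eq_ncard, this, ncard_triple (N.inj i k hik) hi hk']

theorem ShortLeg.deg_b (N : NetConfig G H K L a b) (hij : i ≠ j)
    (hj : ShortLeg G H L a b i j e) : deg H (b j) = 2 := by
  have : H.neighborSet (b j) = {a j, e} := by
    ext v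
    constructor
    · exact fun hv => hj.nb v hv
    · rintro (rfl | rfl)
      · exact N.pair.le hj.ab.symm
      · exact N.pair.le hj.be
  have hne : a j ≠ e := fun h => N.disjoint hij hj.mem (h ▸ N.aL j)
  rw [deg_eq_ncard, this, Set.ncard_pair hne]

/-- Otherwise there is a wounded with triangle `w e (a i)`, pendant edge `e (b j)` and long path `a
i`, `a k`, `b k`. -/
theorem ShortLeg.common_end (N : NetConfig G H K L a b) (hij : i ≠ j) (hik : i ≠ k) (hjk : j ≠ k)
    (hj : ShortLeg G H L a b i j e) (hk : ShortLeg G H L a b i k f) (hie : G.Adj (a i) e) {w : V}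
    (hw : w ∈ L i) (hiw : G.Adj (a i) w) (hew : G.Adj e w) : w = f := by
  by_contra hwf
  exact N.pair.wounded.no_wounded hew.symm hiw.symm hie.symm hj.be.symm (N.adj_triangle hik) hk.ab
    (N.pair.apart fun h => (hj.nb w h.symm).elim (fun h => N.disjoint hij hw (h ▸ N.aL j)) hew.ne')
    (N.pair.apart (N.not_adj_a hik hw hiw.ne'))
    (N.pair.apart fun h => (hk.nb w h.symm).elim (fun h => N.disjoint hik hw (h ▸ N.aL k)) hwf)
    (N.pair.apart (N.not_adj_a hik hj.mem hj.ne)) (N.pair.apart (hj.not_adj N hik hjk))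
    (N.pair.apart (N.not_adj_a hij.symm (N.bL j) (N.b_ne j))).symm
    (N.pair.apart (N.not_adj_a hik.symm (N.bL k) (N.b_ne k))).symm
    (N.pair.apart (N.not_adj_a hjk (N.bL j) (N.b_ne j))) (N.pair.apart (N.bb j k hjk))

theorem ShortLeg.b_notMem (N : NetConfig G H K L a b) (hij : i ≠ j) : b j ∉ L i :=
  N.disjoint hij.symm (N.bL j)

theorem ShortLeg.deg_end_le (hj : ShortLeg G H L a b i j e) (N : NetConfig G H K L a b) {x : V}
    (hx : x ∈ L i) (hex : ¬ G.Adj e x) (hne : e ≠ x) : deg G e + 2 ≤ (L i).ncard + 1 := by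
  have := deg_add_ncard_le (G := G) (v := e) (Q := L i) (S := {e, x}) (E := {b j})
    (by rintro y (rfl | rfl); exacts [hj.mem, hx]) fun y hy => by
      refine (hj.nbe y (N.pair.le hy)).imp_left fun h => ⟨h, ?_⟩
      rintro (rfl | rfl)
      · exact hy.ne rfl
      · exact hex hy
  rwa [Set.ncard_pair hne, Set.ncard_singleton] at this

/-- The wounded along `a j`, `b j`, `e` forces `a i` and `e` to be `o`-heavy. If `a i` also misses
`f`, the degrees of this pair suffice; otherwise use the pair `f`, `y`, where `y` is a common
neighbour of `a i` and `e` with no neighbour outside the leg. -/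
theorem ShortLeg.card_le_of_not_adj (N : NetConfig G H K L a b) (hij : i ≠ j) (hik : i ≠ k)
    (hjk : j ≠ k) (hj : ShortLeg G H L a b i j e) (hk : ShortLeg G H L a b i k f)
    (hie : ¬ G.Adj (a i) e) : Fintype.card V + 2 ≤ 2 * (L i).ncard := by
  have hOH : IsOHeavyPair G (a i) e := by
    by_contra hn
    exact N.wounded_leg hjk hij.symm hik.symm (N.bL j) hj.ab hj.be
      (N.pair.apart (N.not_adj_a hij hj.mem hj.ne)).symm
      (N.pair.apart (N.not_adj_a hik hj.mem hj.ne)).symm ⟨hie, hn⟩ (N.bL k) hk.ab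
      (N.bb j k hjk) (hj.not_adj N hik hjk)
  have hef := hj.end_ne N hik hjk hk
  by_cases hif : G.Adj (a i) f
  · obtain ⟨y, hy, hiy, -, hleaf⟩ := N.pair.exists_leaf (N.lineL i) (N.aL i) hj.mem hOH
    have hyf : f ≠ y := fun h => ShortLeg.b_notMem N hik (hleaf _ (h ▸ N.pair.le hk.be.symm))
    have hye : y ≠ e := fun h => ShortLeg.b_notMem N hij (hleaf _ (h ▸ N.pair.le hj.be.symm))
    have hfy : ¬ G.Adj f y := fun h => hye (hk.common_end N hik hij hjk.symm hj hif hy hiy h)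
    have hai : a j ∉ L i := fun h => N.inj j i hij.symm (N.eq_of_mem h (N.aK j))
    have hOH2 := (N.pair.adj_or_isOHeavyPair (N.lineL i) (N.aL i) hai
      (N.pair.le (N.adj_triangle hij)) hk.mem hy hif hiy hyf).resolve_left hfy
    have h1 := hk.deg_end_le N hy hfy hyf
    have h2 := deg_add_ncard_le (G := G) (v := y) (Q := L i) (S := {y, f}) (E := ∅)
      (by rintro x (rfl | rfl); exacts [hy, hk.mem]) fun x hx => by
        refine Or.inl ⟨hleaf x (N.pair.le hx), ?_⟩
        rintro (rfl | rfl)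
        · exact hx.ne rfl
        · exact hfy hx.symm
    rw [Set.ncard_pair hyf.symm, Set.ncard_empty] at h2
    have h3 := hOH2.2.2
    omega
  · have h1 := hj.deg_end_le N (N.aL i) (fun h => hie h.symm) hj.ne
    have h2 := deg_add_ncard_le (G := G) (v := a i) (Q := L i) (S := {a i, e, f}) (E := {a j, a k})
      (by rintro x (rfl | rfl | rfl); exacts [N.aL i, hj.mem, hk.mem]) fun x hx => by
        rcases N.mem_of_adj_a (N.pair.le hx) with h | h
        · exact Or.inr ((hj.eq_K N hij hik hjk hk h).resolve_left hx.ne')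
        · refine Or.inl ⟨h, ?_⟩
          rintro (rfl | rfl | rfl)
          · exact hx.ne rfl
          · exact hie hx
          · exact hif hx
    rw [ncard_triple hj.ne.symm hk.ne.symm hef, Set.ncard_pair (N.inj j k hjk)] at h2
    have h3 := hOH.2.2
    omega

/-- The pair `a i`, `y` is `o`-heavy, so it has a common neighbour `q` with no neighbour outside the
leg. By `common_end`, `q` misses both `e` and `f`; hence `e`, `q` is `o`-heavy with both degrees
small relative to `|L i|`. -/
theorem ShortLeg.card_le_of_adj (N : NetConfig G H K L a b) (hij : i ≠ j) (hik : i ≠ k)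
    (hjk : j ≠ k) (hj : ShortLeg G H L a b i j e) (hk : ShortLeg G H L a b i k f)
    (hie : G.Adj (a i) e) (hif : G.Adj (a i) f) {y : V} (hy : y ∈ L i) (hyi : y ≠ a i)
    (hyf : y ≠ f) (hey : G.Adj e y) : Fintype.card V + 2 ≤ 2 * (L i).ncard := by
  have hef := hj.end_ne N hik hjk hk
  have hai : a j ∉ L i := fun h => N.inj j i hij.symm (N.eq_of_mem h (N.aK j))
  have hiy : ¬ G.Adj (a i) y := fun h => hyf (hj.common_end N hij hik hjk hk hie hy h hey)
  have hOH := (N.pair.adj_or_isOHeavyPair (N.lineL i) hj.mem (ShortLeg.b_notMem N hij)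
    (N.pair.le hj.be.symm) (N.aL i) hy hie.symm hey hyi.symm).resolve_left hiy
  obtain ⟨q, hq, hiq, -, hleaf⟩ := N.pair.exists_leaf (N.lineL i) (N.aL i) hy hOH
  have hqf : q ≠ f := fun h => ShortLeg.b_notMem N hik (hleaf _ (h ▸ N.pair.le hk.be.symm))
  have hqe : q ≠ e := fun h => ShortLeg.b_notMem N hij (hleaf _ (h ▸ N.pair.le hj.be.symm))
  have heq : ¬ G.Adj e q := fun h => hqf (hj.common_end N hij hik hjk hk hie hq hiq h)
  have hfq : ¬ G.Adj f q := fun h => hqe (hk.common_end N hik hij hjk.symm hj hif hq hiq h)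
  have hOH2 := (N.pair.adj_or_isOHeavyPair (N.lineL i) (N.aL i) hai
    (N.pair.le (N.adj_triangle hij)) hj.mem hq hie hiq hqe.symm).resolve_left heq
  have h1 := hj.deg_end_le N hq heq hqe.symm
  have h2 := deg_add_ncard_le (G := G) (v := q) (Q := L i) (S := {q, f}) (E := ∅)
    (by rintro x (rfl | rfl); exacts [hq, hk.mem]) fun x hx => by
      refine Or.inl ⟨hleaf x (N.pair.le hx), ?_⟩
      rintro (rfl | rfl)
      · exact hx.ne rfl
      · exact hfq hx.symm
  rw [Set.ncard_pair hqf, Set.ncard_empty] at h2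
  have h3 := hOH2.2.2
  omega

/-- If two legs are short, then the line of the third leg has more than `n / 2` vertices. -/
theorem ShortLeg.card_le (N : NetConfig G H K L a b) (hij : i ≠ j) (hik : i ≠ k)
    (hjk : j ≠ k) (hj : ShortLeg G H L a b i j e) (hk : ShortLeg G H L a b i k f) :
    Fintype.card V + 2 ≤ 2 * (L i).ncard := by
  by_cases hie : G.Adj (a i) e
  swap
  · exact hj.card_le_of_not_adj N hij hik hjk hk hie
  by_cases hif : G.Adj (a i) f
  swap
  · exact hk.card_le_of_not_adj N hik hij hjk.symm hj hif
  have hef := hj.end_ne N hik hjk hk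
  by_cases hadj : G.Adj e f
  -- Since `b i` differs from `a i`, `e` and `f`, some edge of `G` in `L i` leaves `{e, f}` after
  -- deleting `a i`.
  · obtain ⟨s, hs, hsS, -, y, hy, hyS, hyi, hsy⟩ := N.pair.linked (L i) (N.lineL i) {a i} {e, f}
      Set.subsingleton_singleton e hj.mem (Or.inl rfl) hj.ne (b i) (N.bL i)
      (by
        rintro (h | h)
        · exact N.bb i j hij (h ▸ N.pair.le hj.be.symm)
        · exact N.bb i k hik (h ▸ N.pair.le hk.be.symm)) (N.b_ne i)
    rcases hsS with rfl | rfl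
    · exact hj.card_le_of_adj N hij hik hjk hk hie hif hy hyi (fun h => hyS (Or.inr h)) hsy
    · exact hk.card_le_of_adj N hik hij hjk.symm hj hif hie hy hyi (fun h => hyS (Or.inl h)) hsy
  · have hai : a j ∉ L i := fun h => N.inj j i hij.symm (N.eq_of_mem h (N.aK j))
    have hOH := (N.pair.adj_or_isOHeavyPair (N.lineL i) (N.aL i) hai
      (N.pair.le (N.adj_triangle hij)) hj.mem hk.mem hie hif hef).resolve_left hadj
    have h1 := hj.deg_end_le N hk.mem hadj hef
    have h2 := hk.deg_end_le N hj.mem (fun h => hadj h.symm) hef.symm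
    have h3 := hOH.2.2
    omega

theorem ShortLeg.isHeavy (N : NetConfig G H K L a b) (hij : i ≠ j) (hik : i ≠ k)
    (hjk : j ≠ k) (hj : ShortLeg G H L a b i j e) (hk : ShortLeg G H L a b i k f) {v : V}
    (hv : v ∈ L i) : IsHeavy H v := by
  have h1 := hj.card_le N hij hik hjk hk
  have h2 : (L i \ {v}).ncard ≤ deg H v := by
    rw [deg_eq_ncard]
    exact Set.ncard_le_ncard (fun x hx => (N.lineL i).1 v hv x hx.1 fun h => hx.2 h.symm)
      (Set.toFinite _)
  have h3 := Set.ncard_sdiff_singleton_add_one hv (Set.toFinite _)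
  unfold IsHeavy
  omega

end Short

/-! ### From the configuration to `q`-heaviness -/

/-- At most one leg contains an `o`-heavy pair of `G`. -/
theorem exists_light (N : NetConfig G H K L a b) : ∃ i, ∀ j, j ≠ i → LightLeg G L j := by
  by_cases h : ∃ i, ¬ LightLeg G L i
  · obtain ⟨i, hi⟩ := h
    refine ⟨i, fun j hji s hs t ht hst => hi fun s' hs' t' ht' hst' => ?_⟩
    exact N.pair.not_heavy_disjoint (N.lineL j) (N.lineL i) (fun x hx => N.disjoint hji hx) hs ht
      hs' ht' hst hst'
  · push Not at h
    exact ⟨0, fun j _ => h j⟩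

end NetConfig

theorem ClosurePair.exists_netConfig [Fintype V] {G H : SimpleGraph V} (h : ClosurePair G H)
    (f : net ↪g H) (hf : ¬ IsPHeavy H f) :
    ∃ K L, NetConfig G H K L (fun i => f (Sum.inl i)) fun i => f (Sum.inr i) := by
  have haa : ∀ i j, i ≠ j → H.Adj (f (Sum.inl i)) (f (Sum.inl j)) := fun i j hij =>
    f.map_adj_iff.2 (net_adj_inl hij)
  have hab : ∀ i j, H.Adj (f (Sum.inl i)) (f (Sum.inr j)) ↔ i = j := fun i j =>
    f.map_adj_iff.trans net_adj_inl_inr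
  have hbb : ∀ i j, ¬ H.Adj (f (Sum.inr i)) (f (Sum.inr j)) := fun i j hh =>
    not_net_adj_inr (f.map_adj_iff.1 hh)
  obtain ⟨K, hK, h0, h1⟩ := h.diamond.exists_isLine (haa 0 1 (by decide))
  have hL := fun i => h.diamond.exists_isLine ((hab i i).2 rfl)
  choose L hL haL hbL using hL
  have haK : ∀ i, f (Sum.inl i) ∈ K := by
    intro i
    by_cases hi0 : i = 0
    · exact hi0 ▸ h0
    by_cases hi1 : i = 1
    · exact hi1 ▸ h1
    exact hK.2 _ h0 _ h1 (haa 0 1 (by decide)).ne _ (haa i 0 hi0) (haa i 1 hi1)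
  refine ⟨K, L, h, hK, hL, haK, haL, hbL, fun i hi => ?_, fun i j hij => (haa i j hij).ne,
    fun i j _ => hbb i j, fun i j hij => ?_⟩
  · obtain ⟨j, hj, -⟩ := exists_third i i
    exact hj ((hab j i).1 (hK.1 _ (haK j) _ hi fun e => by simpa using f.injective e))
  · by_contra hle
    exact hf ⟨i, j, haa i j hij, not_lt.1 hle⟩

theorem ClosurePair.isNPQHeavy [Fintype V] {G H : SimpleGraph V} (h : ClosurePair G H) :
    IsNPQHeavy H := by
  intro f
  by_cases hf : IsPHeavy H f
  · exact Or.inl hf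
  obtain ⟨K, L, N⟩ := h.exists_netConfig f hf
  obtain ⟨i, hi⟩ := N.exists_light
  have hshort : ∀ j, j ≠ i → ∃ e, NetConfig.ShortLeg G H L (fun i => f (Sum.inl i))
      (fun i => f (Sum.inr i)) i j e := by
    intro j hj
    obtain ⟨k, hki, hkj⟩ := exists_third i j
    exact N.exists_shortLeg hj.symm hki.symm hkj.symm (hi j hj) (hi k hki)
  have key : ∀ j, j ≠ i → ∃ k e e', k ≠ i ∧ k ≠ j ∧
      NetConfig.ShortLeg G H L (fun i => f (Sum.inl i)) (fun i => f (Sum.inr i)) i j e ∧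
      NetConfig.ShortLeg G H L (fun i => f (Sum.inl i)) (fun i => f (Sum.inr i)) i k e' := by
    intro j hj
    obtain ⟨k, hki, hkj⟩ := exists_third i j
    obtain ⟨e, he⟩ := hshort j hj
    obtain ⟨e', he'⟩ := hshort k hki
    exact ⟨k, e, e', hki, hkj, he, he'⟩
  have hheavy : ∀ v ∈ L i, IsHeavy H v := by
    intro v hv
    obtain ⟨j, hji, -⟩ := exists_third i i
    obtain ⟨k, e, e', hki, hkj, he, he'⟩ := key j hji
    exact he.isHeavy N hji.symm hki.symm hkj.symm he' hv
  refine Or.inr ⟨i, hheavy _ (N.aL i), hheavy _ (N.bL i), fun j hji => ?_⟩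
  obtain ⟨k, e, e', hki, hkj, he, he'⟩ := key j hji
  refine ⟨he.deg_a N hji.symm hki.symm hkj.symm he', he.deg_b N hji.symm, fun c hc hca => ?_⟩
  rw [(he.nb c hc).resolve_left hca]
  exact hheavy e he.mem

end CClosure

/-- If `G` is a finite 2-connected `{K_{1,3}, W}`-`o`-heavy graph, then its `c`-closure is
claw-free and `N`-`pq`-heavy. -/
theorem mainTheorem5 {V : Type*} [Fintype V] (G : SimpleGraph V)
    (h2 : CClosure.IsTwoConnected G)
    (hclaw : CClosure.IsOHeavyFor CClosure.claw G)
    (hW : CClosure.IsOHeavyFor CClosure.wounded G) :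
    ∀ H : SimpleGraph V, CClosure.IsCClosure G H →
      CClosure.IsFree CClosure.claw H ∧ CClosure.IsNPQHeavy H := by
  intro H hH
  have h := hH.closurePair h2 hclaw hW
  exact ⟨h.claw.isFree, h.isNPQHeavy⟩
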